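/- Call a matrix $A\in\mathbb{Q}^{n\times n}$ stochastic if its entries are nonnegative and $A\mathbf 1=\mathbf 1$, where $\mathbf 1=(1,\dots,1)^\top$, and undirected if $a_{ij}>0\Leftrightarrow a_{ji}>0$ for all $i,j$. Given $n$ and two stochastic undirected matrices $A_1,A_2\in\mathbb{Q}^{n\times n}$, consider the switched system $x(t+1)=A_{\sigma(t)}x(t)$, $x(0)=x_0$. The asymptotic stability problem asks whether, for every initial condition $x_0\in\mathbb{R}^n$ and every switching sequence $\sigma:\mathbb{N}\to\{1,2\}$, the trajectory $x(t)$ converges to a multiple of $\mathbf 1$ as $t\to\infty$. Then, for pairs of stochastic undirected matrices, the asymptotic stability problem can be decided in polynomial time: there are a Turing machine and a polynomial $T$ such that, for every $n$ and every pair $(A_1,A_2)$ of stochastic undirected matrices in $\mathbb{Q}^{n\times n}$, given as a word $w$ that lists the entries of $A_1$ and $A_2$ row by row, each as a fraction in lowest terms with numerator and denominator written in binary, the machine halts on $w$ after at most $T(|w|)$ steps and outputs whether the answer to the asymptotic stability problem for $(A_1,A_2)$ is positive. -/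

import Mathlib

open Filter Topology

namespace Consensus

/-- The trajectory `x(0) = x₀`, `x(t+1) = A_{σ(t)} x(t)` of the switched system of the family of
matrices `A` along the switching sequence `σ`. -/
def trajectory {ι : Type*} {n : ℕ} (A : ι → Matrix (Fin n) (Fin n) ℝ) (σ : ℕ → ι)
    (x₀ : Fin n → ℝ) : ℕ → Fin n → ℝ
  | 0 => x₀
  | t + 1 => (A (σ t)).mulVec (trajectory A σ x₀ t)

/-- A positive answer to the asymptotic stability problem: for every initial condition and every
switching sequence, the trajectory converges to a multiple of the all-ones vector. -/
def AsymptoticallyStable {ι : Type*} {n : ℕ} (A : ι → Matrix (Fin n) (Fin n) ℝ) : Prop :=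
  ∀ (x₀ : Fin n → ℝ) (σ : ℕ → ι), ∃ c : ℝ,
    Tendsto (trajectory A σ x₀) atTop (𝓝 (c • (1 : Fin n → ℝ)))

/-- A matrix is undirected if `a_{ij} > 0 ↔ a_{ji} > 0`. -/
def IsUndirected {n : ℕ} (A : Matrix (Fin n) (Fin n) ℚ) : Prop :=
  ∀ i j, 0 < A i j ↔ 0 < A j i

/-- An instance of the problem: two undirected stochastic matrices of the same size, with rational
entries. -/
structure Problem where
  /-- the size of the matrices -/
  n : ℕ
  /-- the two matrices -/
  mat : Fin 2 → Matrix (Fin n) (Fin n) ℚ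
  stochastic : ∀ k, mat k ∈ Matrix.rowStochastic ℚ (Fin n)
  undirected : ∀ k, IsUndirected (mat k)

/-- The answer to the instance is positive. The initial conditions are real vectors. -/
def Problem.Stable (P : Problem) : Prop :=
  AsymptoticallyStable fun k => (P.mat k).map ((↑) : ℚ → ℝ)

/-! ### The encoding of instances as words -/

/-- The input alphabet. -/
inductive Letter
  | bit (b : Bool)
  | minus
  | slash
  | endEntry
  | endRow
  | endMatrix
  deriving DecidableEq, Fintype

/-- The concatenation of the words `f x`, for `x` in the list, each followed by the letter `s`. -/
def encodeBlocks {α : Type*} (s : Letter) (f : α → List Letter) (l : List α) : List Letter :=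
  l.flatMap fun x => f x ++ [s]

/-- A natural number in binary, least significant bit first. -/
def encodeNat (m : ℕ) : List Letter :=
  m.bits.map Letter.bit

/-- A rational number: sign, and numerator and denominator (in lowest terms) in binary. -/
def encodeRat (q : ℚ) : List Letter :=
  (if q < 0 then [Letter.minus] else []) ++
    (encodeNat q.num.natAbs ++ Letter.slash :: encodeNat q.den)

/-- A row of a matrix: its entries, each followed by `endEntry`. -/
def encodeRow (r : List ℚ) : List Letter :=
  encodeBlocks Letter.endEntry encodeRat r

/-- A matrix: its rows, each followed by `endRow`. -/
def encodeMatrix (M : List (List ℚ)) : List Letter :=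
  encodeBlocks Letter.endRow encodeRow M

/-- The list of the rows of a matrix. -/
def matrixRows {n : ℕ} (A : Matrix (Fin n) (Fin n) ℚ) : List (List ℚ) :=
  List.ofFn fun i => List.ofFn fun j => A i j

/-- An instance: its two matrices, each followed by `endMatrix`. -/
def encodeProblem (P : Problem) : List Letter :=
  encodeBlocks Letter.endMatrix encodeMatrix [matrixRows (P.mat 0), matrixRows (P.mat 1)]

/-! ### The encoding is injective -/

theorem mem_encodeBlocks {α : Type*} {s t : Letter} {f : α → List Letter} {l : List α}
    (h : t ∈ encodeBlocks s f l) : t = s ∨ ∃ x, t ∈ f x := by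
  simp only [encodeBlocks, List.mem_flatMap, List.mem_append, List.mem_singleton] at h
  obtain ⟨x, _, h | h⟩ := h
  · exact Or.inr ⟨x, h⟩
  · exact Or.inl h

theorem append_cons_cancel {s : Letter} : ∀ {a b u v : List Letter}, s ∉ a → s ∉ b →
    a ++ s :: u = b ++ s :: v → a = b ∧ u = v
  | [], [], _, _, _, _, h => by simpa using h
  | [], c :: b, _, _, _, hb, h => by simp at h hb; exact absurd h.1 hb.1
  | c :: a, [], _, _, ha, _, h => by simp at h ha; exact absurd h.1.symm ha.1
  | c :: a, d :: b, u, v, ha, hb, h => by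
    simp only [List.cons_append, List.cons.injEq] at h
    obtain ⟨h1, h2⟩ := append_cons_cancel (List.not_mem_of_not_mem_cons ha)
      (List.not_mem_of_not_mem_cons hb) h.2
    exact ⟨by rw [h.1, h1], h2⟩

theorem encodeBlocks_injective {α : Type*} {s : Letter} {f : α → List Letter}
    (hf : Function.Injective f) (hs : ∀ x, s ∉ f x) : Function.Injective (encodeBlocks s f)
  | [], [], _ => rfl
  | [], _ :: _, h => by simp [encodeBlocks] at h
  | _ :: _, [], h => by simp [encodeBlocks] at h
  | x :: l, y :: m, h => by
    have h' : f x ++ s :: encodeBlocks s f l = f y ++ s :: encodeBlocks s f m := by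
      simpa [encodeBlocks] using h
    obtain ⟨h1, h2⟩ := append_cons_cancel (hs x) (hs y) h'
    rw [hf h1, encodeBlocks_injective hf hs h2]

theorem bits_injective : Function.Injective Nat.bits := by
  intro a
  induction a using Nat.binaryRec' with
  | zero =>
    intro b hb
    induction b using Nat.binaryRec' with
    | zero => rfl
    | bit c m hm _ => rw [Nat.bits_append_bit _ _ hm] at hb; simp at hb
  | bit c m hm ih =>
    intro b hb
    induction b using Nat.binaryRec' with
    | zero => rw [Nat.bits_append_bit _ _ hm] at hb; simp at hb
    | bit d k hk _ =>
      rw [Nat.bits_append_bit _ _ hm, Nat.bits_append_bit _ _ hk, List.cons.injEq] at hb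
      rw [hb.1, ih hb.2]

theorem encodeNat_injective : Function.Injective encodeNat := fun _ _ h =>
  bits_injective (List.map_injective_iff.2 (fun _ _ hx => Letter.bit.inj hx) h)

theorem encodeRat_injective : Function.Injective encodeRat := by
  have key : ∀ p q : ℚ, encodeNat p.num.natAbs ++ Letter.slash :: encodeNat p.den =
      encodeNat q.num.natAbs ++ Letter.slash :: encodeNat q.den →
      p.num.natAbs = q.num.natAbs ∧ p.den = q.den := by
    intro p q h
    obtain ⟨h1, h2⟩ := append_cons_cancel (by simp [encodeNat]) (by simp [encodeNat]) h
    exact ⟨encodeNat_injective h1, encodeNat_injective h2⟩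
  have mixed : ∀ (m : ℕ) (u v : List Letter),
      Letter.minus :: u ≠ encodeNat m ++ Letter.slash :: v := by
    intro m u v h
    unfold encodeNat at h
    cases hb : m.bits <;> simp [hb] at h
  intro p q h
  unfold encodeRat at h
  have hp : p.num < 0 ↔ p < 0 := Rat.num_neg
  have hq : q.num < 0 ↔ q < 0 := Rat.num_neg
  by_cases h1 : p < 0 <;> by_cases h2 : q < 0
  · simp only [h1, h2, if_true, List.cons_append, List.nil_append, List.cons.injEq,
      true_and] at h
    obtain ⟨a, b⟩ := key p q h
    exact Rat.ext (by have := hp.2 h1; have := hq.2 h2; omega) b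
  · simp only [h1, h2, if_true, if_false, List.cons_append, List.nil_append] at h
    exact absurd h (mixed _ _ _)
  · simp only [h1, h2, if_true, if_false, List.cons_append, List.nil_append] at h
    exact absurd h.symm (mixed _ _ _)
  · simp only [h1, h2, if_false, List.nil_append] at h
    obtain ⟨a, b⟩ := key p q h
    rw [← hp] at h1
    rw [← hq] at h2
    exact Rat.ext (by omega) b

theorem mem_encodeRat {q : ℚ} {t : Letter} (h : t ∈ encodeRat q) :
    t = Letter.minus ∨ t = Letter.slash ∨ ∃ b, t = Letter.bit b := by
  unfold encodeRat encodeNat at h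
  split_ifs at h <;> cases t <;> simp_all

theorem endEntry_not_mem (q : ℚ) : Letter.endEntry ∉ encodeRat q := fun h => by
  simpa using mem_encodeRat h

theorem endRow_not_mem (r : List ℚ) : Letter.endRow ∉ encodeRow r := fun h => by
  rcases mem_encodeBlocks h with h | ⟨q, h⟩
  · simp at h
  · simpa using mem_encodeRat h

theorem endMatrix_not_mem (M : List (List ℚ)) : Letter.endMatrix ∉ encodeMatrix M := fun h => by
  rcases mem_encodeBlocks h with h | ⟨r, h⟩
  · simp at h
  rcases mem_encodeBlocks h with h | ⟨q, h⟩
  · simp at h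
  · simpa using mem_encodeRat h

theorem encodeMatrix_injective : Function.Injective encodeMatrix :=
  encodeBlocks_injective (encodeBlocks_injective encodeRat_injective endEntry_not_mem)
    endRow_not_mem

theorem matrixRows_injective {n : ℕ} : Function.Injective (matrixRows (n := n)) := by
  intro A B h
  ext i j
  have h1 := congrFun (List.ofFn_injective h) i
  exact congrFun (List.ofFn_injective h1) j

/-- Distinct instances have distinct encodings. -/
theorem encodeProblem_injective : Function.Injective encodeProblem := by
  intro P Q h
  have h' := encodeBlocks_injective encodeMatrix_injective endMatrix_not_mem h
  simp only [List.cons.injEq, and_true] at h'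
  obtain ⟨n, A, _, _⟩ := P
  obtain ⟨m, B, _, _⟩ := Q
  dsimp only at h'
  obtain rfl : n = m := by simpa [matrixRows] using congrArg List.length h'.1
  obtain rfl : A = B := by
    funext k
    fin_cases k
    · exact matrixRows_injective h'.1
    · exact matrixRows_injective h'.2
  rfl

/-! ### Polynomial time -/

/-- The property `p` of the instances in `α`, presented through the encoding `enc`, is decided by a
(multi-stack) Turing machine that, on the encoding `w` of any instance, halts after at most
`T(|w|)` steps with the truth value of `p` as its output, where `T` is a polynomial. -/
def PolyTimeDecidable {α Γ : Type} (enc : α → List Γ) (p : α → Prop) : Prop :=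
  ∃ f : α → Bool, (∀ a, f a = true ↔ p a) ∧
    Nonempty (Turing.TM2ComputableInPolyTime enc Computability.encodeBool f)

end Consensus

/-!
The answer is positive exactly if all sufficiently long products of the two matrices are scrambling,
that is, if any two of their rows have a common positive entry: scrambling products contract the
spread of the coordinates (`mulVec_sub_le`, `asymptoticallyStable_of_scrambling`). This depends only
on the two graphs of positive entries, in which words over the two letters label paths (`Reach`).

If arbitrarily long words fail to be scrambling, then, by the pigeonhole principle, some nonempty word
maps each of two disjoint nonempty sets of vertices into itself (`Splits`). In undirected graphs a
path that goes along an edge labelled `k` may go back along it, so that every set of vertices is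
contained in its image under the word `k k`; hence `k k` can be deleted from a word that splits
(`Splits.remove_pair`). Such words can also be rotated. After all deletions, a power of one letter or
an alternating word is left (`not_splits_of_alternating`). Therefore only three products have to be
examined: the two matrices, and the product of one and the other. For each of them, the set of the
pairs of vertices that can reach a common vertex increases with the exponent and is constant from the
exponent `n²` on (`reach_alternating_of_le`); if it does not contain all pairs, then two rows of
the powers have disjoint supports for ever, and the trajectories along the corresponding
periodic sequence are not all convergent to multiples of the vector of ones
(`AsymptoticallyStable.exists_common`). This gives the criterion `asymptoticallyStable_iff`.

The sets of pairs are Boolean matrices, and the pairs that can reach a pair in `X` along the letter `k`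
form the matrix `M X Mᵀ = M (M Xᵀ)ᵀ`, where `M` is the Boolean matrix of the graph `k`. So the
criterion is checked by iterating `X ↦ M Xᵀ` a polynomial number of times. To obtain a Turing
machine, a small language of structured programs on stacks (`Prog`) is compiled to multi-stack
machines, with a proof that running times are preserved (`Prog.Exec.evalsTo`). The program
`Prog.program` reads the positivity of the entries off the input, with one tick of a counter per
entry, iterates the Boolean products as often as the counter says, for each of the three pairs of
letters, and checks that all entries of the results are true (`Prog.exec_program`).
-/

namespace Consensus

/-! ### Words of relations and scrambling -/

section Words

variable {ι α : Type*} {R : ι → α → α → Prop}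

/-- `Reach R w i j`: the word `w` labels a path from `i` to `j`, in the graphs with edge relations
`R k`. For stochastic matrices this says that the entry `(i, j)` of the product along `w` is
positive. -/
def Reach (R : ι → α → α → Prop) : List ι → α → α → Prop
  | [], i, j => i = j
  | k :: w, i, j => ∃ m, R k i m ∧ Reach R w m j

theorem reach_append {u v : List ι} {i j : α} :
    Reach R (u ++ v) i j ↔ ∃ m, Reach R u i m ∧ Reach R v m j := by
  induction u generalizing i with
  | nil => simp [Reach]
  | cons k u ih =>
    simp only [List.cons_append, Reach, ih]
    constructor
    · rintro ⟨m, h, l, h1, h2⟩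
      exact ⟨l, ⟨m, h, h1⟩, h2⟩
    · rintro ⟨l, ⟨m, h, h1⟩, h2⟩
      exact ⟨m, h, l, h1, h2⟩

theorem exists_reach (total : ∀ k i, ∃ j, R k i j) (w : List ι) (i : α) : ∃ j, Reach R w i j := by
  induction w generalizing i with
  | nil => exact ⟨i, rfl⟩
  | cons k w ih =>
    obtain ⟨m, hm⟩ := total k i
    obtain ⟨j, hj⟩ := ih m
    exact ⟨j, m, hm, hj⟩

/-- A word is scrambling if any two starting points have a common end point along it. -/
def Scrambling (R : ι → α → α → Prop) (w : List ι) : Prop :=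
  ∀ i j, ∃ l, Reach R w i l ∧ Reach R w j l

theorem Scrambling.append_right (total : ∀ k i, ∃ j, R k i j) {u : List ι} (h : Scrambling R u)
    (v : List ι) : Scrambling R (u ++ v) := by
  intro i j
  obtain ⟨l, h1, h2⟩ := h i j
  obtain ⟨m, hm⟩ := exists_reach total v l
  exact ⟨m, reach_append.2 ⟨l, h1, hm⟩, reach_append.2 ⟨l, h2, hm⟩⟩

theorem Scrambling.append_left (total : ∀ k i, ∃ j, R k i j) (u : List ι) {v : List ι}
    (h : Scrambling R v) : Scrambling R (u ++ v) := by
  intro i j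
  obtain ⟨i', hi⟩ := exists_reach total u i
  obtain ⟨j', hj⟩ := exists_reach total u j
  obtain ⟨l, h1, h2⟩ := h i' j'
  exact ⟨l, reach_append.2 ⟨i', hi, h1⟩, reach_append.2 ⟨j', hj, h2⟩⟩

/-- The set of the end points of the paths labelled `w` that start in `S`. -/
def post (R : ι → α → α → Prop) (w : List ι) (S : Set α) : Set α :=
  {j | ∃ i ∈ S, Reach R w i j}

theorem post_append (u v : List ι) (S : Set α) : post R (u ++ v) S = post R v (post R u S) := by
  ext j
  simp only [post, Set.mem_ofPred_eq, reach_append]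
  constructor
  · rintro ⟨i, hi, m, h1, h2⟩
    exact ⟨m, ⟨i, hi, h1⟩, h2⟩
  · rintro ⟨m, ⟨i, hi, h1⟩, h2⟩
    exact ⟨i, hi, m, h1, h2⟩

theorem post_mono (w : List ι) {S T : Set α} (h : S ⊆ T) : post R w S ⊆ post R w T := by
  rintro j ⟨i, hi, hj⟩
  exact ⟨i, h hi, hj⟩

theorem subset_post_pair (symm : ∀ k i j, R k i j → R k j i) (total : ∀ k i, ∃ j, R k i j)
    (k : ι) (S : Set α) : S ⊆ post R [k, k] S := by
  intro i hi
  obtain ⟨j, hj⟩ := total k i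
  exact ⟨i, hi, j, hj, i, symm _ _ _ hj, rfl⟩

/-- The word `w` preserves each of two disjoint nonempty sets. This is what prevents the powers of
`w` from being scrambling. -/
def Splits (R : ι → α → α → Prop) (w : List ι) : Prop :=
  ∃ S T : Set α, S.Nonempty ∧ T.Nonempty ∧ Disjoint S T ∧ post R w S ⊆ S ∧ post R w T ⊆ T

theorem Splits.not_scrambling {w : List ι} (h : Splits R w) : ¬ Scrambling R w := by
  obtain ⟨S, T, ⟨i, hi⟩, ⟨j, hj⟩, hd, hS, hT⟩ := h
  intro hw
  obtain ⟨l, h1, h2⟩ := hw i j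
  exact Set.disjoint_left.1 hd (hS ⟨i, hi, h1⟩) (hT ⟨j, hj, h2⟩)

theorem post_power_subset {w : List ι} {S : Set α} (h : post R w S ⊆ S) (t : ℕ) :
    post R (List.replicate t w).flatten S ⊆ S := by
  induction t with
  | zero =>
    rintro j ⟨i, hi, rfl⟩
    exact hi
  | succ t ih =>
    rw [List.replicate_succ, List.flatten_cons, post_append]
    exact (post_mono _ h).trans ih

theorem Splits.power {w : List ι} (h : Splits R w) (t : ℕ) :
    Splits R (List.replicate t w).flatten := by
  obtain ⟨S, T, hS, hT, hd, h1, h2⟩ := h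
  exact ⟨S, T, hS, hT, hd, post_power_subset h1 t, post_power_subset h2 t⟩

/-- In undirected graphs two equal consecutive letters can be deleted: going back and forth along an
edge, a path with these letters may skip them. -/
theorem Splits.remove_pair (symm : ∀ k i j, R k i j → R k j i) (total : ∀ k i, ∃ j, R k i j)
    {u v : List ι} {k : ι} (h : Splits R (u ++ k :: k :: v)) : Splits R (u ++ v) := by
  have key : ∀ S : Set α, post R (u ++ v) S ⊆ post R (u ++ k :: k :: v) S := by
    intro S
    rw [show u ++ k :: k :: v = u ++ ([k, k] ++ v) by simp, post_append, post_append, post_append]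
    exact post_mono _ (subset_post_pair symm total k _)
  obtain ⟨S, T, hS, hT, hd, h1, h2⟩ := h
  exact ⟨S, T, hS, hT, hd, (key S).trans h1, (key T).trans h2⟩

theorem Splits.rotate (total : ∀ k i, ∃ j, R k i j) {u v : List ι} (h : Splits R (u ++ v)) :
    Splits R (v ++ u) := by
  have ne : ∀ (w : List ι) {S : Set α}, S.Nonempty → (post R w S).Nonempty := by
    rintro w S ⟨i, hi⟩
    obtain ⟨j, hj⟩ := exists_reach total w i
    exact ⟨j, i, hi, hj⟩
  have sub : ∀ {S : Set α}, post R (u ++ v) S ⊆ S →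
      post R (v ++ u) (post R u S) ⊆ post R u S := by
    intro S hS
    rw [post_append, ← post_append u v]
    exact post_mono _ hS
  obtain ⟨S, T, hS, hT, hd, h1, h2⟩ := h
  refine ⟨post R u S, post R u T, ne u hS, ne u hT, ?_, sub h1, sub h2⟩
  -- a common point of the two images would lead back into both sets
  rw [Set.disjoint_left]
  intro l hl hl'
  obtain ⟨j, hj⟩ := exists_reach total v l
  rw [post_append] at h1 h2
  exact Set.disjoint_left.1 hd (h1 ⟨l, hl, hj⟩) (h2 ⟨l, hl', hj⟩)

/-- If no nonempty word splits, then all sufficiently long words are scrambling: along a long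
word that is not, the pair of the sets reached from two starting points takes some value twice. -/
theorem exists_length_forall_scrambling [Finite α] (total : ∀ k i, ∃ j, R k i j)
    (h : ∀ w, w ≠ [] → ¬ Splits R w) : ∃ L, ∀ w : List ι, w.length = L → Scrambling R w := by
  classical
  cases nonempty_fintype α
  refine ⟨Fintype.card (Set α × Set α), fun w hw => ?_⟩
  by_contra hns
  simp only [Scrambling, not_forall, not_exists, not_and] at hns
  obtain ⟨i, j, hij⟩ := hns
  let f : Fin (w.length + 1) → Set α × Set α := fun t =>
    (post R (w.take t) {i}, post R (w.take t) {j})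
  have hcard : Fintype.card (Set α × Set α) < Fintype.card (Fin (w.length + 1)) := by
    rw [Fintype.card_fin, hw]
    exact Nat.lt_succ_self _
  obtain ⟨s, t, hne, hst⟩ := Fintype.exists_ne_map_eq_of_card_lt f hcard
  wlog hlt : s < t generalizing s t
  · exact this t s hne.symm hst.symm (lt_of_le_of_ne (not_lt.1 hlt) hne.symm)
  have ht : (t : ℕ) ≤ w.length := Nat.lt_succ_iff.1 t.2
  have hst' : (s : ℕ) < t := hlt
  set u := (w.take t).drop s with hu
  have htake : w.take t = w.take s ++ u := by
    conv_lhs => rw [← List.take_append_drop s (w.take t), List.take_take, min_eq_left hst'.le]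
  have hune : u ≠ [] := by
    intro h0
    have := congrArg List.length h0
    simp [hu] at this
    omega
  have hpost : ∀ p : α, post R (w.take t) {p} = post R u (post R (w.take s) {p}) := fun p => by
    rw [htake, post_append]
  have hnonempty : ∀ p : α, (post R (w.take s) {p}).Nonempty := fun p => by
    obtain ⟨q, hq⟩ := exists_reach total (w.take s) p
    exact ⟨q, p, rfl, hq⟩
  simp only [f, Prod.mk.injEq] at hst
  refine h u hune ⟨post R (w.take s) {i}, post R (w.take s) {j}, hnonempty i, hnonempty j, ?_,
    ?_, ?_⟩
  · rw [Set.disjoint_left]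
    rintro l ⟨_, rfl, hl⟩ ⟨_, rfl, hl'⟩
    obtain ⟨m, hm⟩ := exists_reach total (w.drop s) l
    refine hij m ?_ ?_
    · rw [← List.take_append_drop s w]
      exact reach_append.2 ⟨l, hl, hm⟩
    · rw [← List.take_append_drop s w]
      exact reach_append.2 ⟨l, hl', hm⟩
  · rw [← hpost, hst.1]
  · rw [← hpost, hst.2]

end Words

/-! ### Two undirected graphs: only alternating words matter -/

/-- The word of length `2 t` that alternates between `a` and `b`. -/
def alternating {ι : Type*} (a b : ι) (t : ℕ) : List ι :=
  (List.replicate t [a, b]).flatten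

section TwoLetters

variable {α : Type*}

theorem alternating_succ {ι : Type*} (a b : ι) (t : ℕ) :
    alternating a b (t + 1) = a :: b :: alternating a b t := by
  simp [alternating, List.replicate_succ]

theorem alternating_add {ι : Type*} (a b : ι) (s t : ℕ) :
    alternating a b (s + t) = alternating a b s ++ alternating a b t := by
  rw [alternating, List.replicate_add, List.flatten_append]
  rfl

theorem alternating_succ_shift {ι : Type*} (a b : ι) (t : ℕ) :
    alternating a b (t + 1) = a :: (alternating b a t ++ [b]) := by
  induction t with
  | zero => rfl
  | succ t ih =>
    rw [alternating_succ, ih, alternating_succ]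
    rfl

theorem alternating_flatten {ι : Type*} (a b : ι) (s t : ℕ) :
    (List.replicate t (alternating a b s)).flatten = alternating a b (t * s) := by
  induction t with
  | zero => simp [alternating]
  | succ t ih =>
    rw [List.replicate_succ, List.flatten_cons, ih, ← alternating_add]
    congr 1
    ring

/-- A word over two letters without equal neighbours is alternating. -/
theorem exists_eq_alternating {a : Fin 2} {u : List (Fin 2)} (h : (a :: u).IsChain (· ≠ ·)) :
    ∃ m, a :: u = alternating a a.rev m ∨ a :: u = a :: alternating a.rev a m := by
  induction u generalizing a with
  | nil => exact ⟨0, Or.inr rfl⟩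
  | cons b u ih =>
    rw [List.isChain_cons_cons] at h
    obtain rfl : b = a.rev := by
      clear ih
      have := h.1
      rw [Fin.ext_iff, Fin.val_rev]
      rw [Ne, Fin.ext_iff] at this
      omega
    obtain ⟨m, hm | hm⟩ := ih h.2
    · refine ⟨m, Or.inr ?_⟩
      rw [hm, Fin.rev_rev]
    · refine ⟨m + 1, Or.inl ?_⟩
      rw [hm, alternating_succ, Fin.rev_rev]

/-- For two undirected graphs, no nonempty word splits if alternating words are eventually scrambling:
a shortest word that splits would be `a`, `a a` or alternating, since otherwise two equal neighbours
could be deleted from it or from a rotation of it. -/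
theorem not_splits_of_alternating {R : Fin 2 → α → α → Prop}
    (symm : ∀ k i j, R k i j → R k j i) (total : ∀ k i, ∃ j, R k i j)
    (h : ∀ a b, ∃ N, Scrambling R (alternating a b N)) :
    ∀ w, w ≠ [] → ¬ Splits R w := by
  have halt : ∀ a b m, m ≠ 0 → ¬ Splits R (alternating a b m) := by
    intro a b m hm hs
    obtain ⟨N, hN⟩ := h a b
    have h1 := (hs.power N).not_scrambling
    rw [alternating_flatten] at h1
    obtain ⟨m, rfl⟩ := Nat.exists_eq_succ_of_ne_zero hm
    rw [show N * m.succ = N + N * m by rw [Nat.mul_succ, add_comm], alternating_add] at h1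
    exact h1 (hN.append_right total _)
  have hlen : ∀ n, ∀ w : List (Fin 2), w.length = n → w ≠ [] → ¬ Splits R w := by
    intro n
    induction n using Nat.strong_induction_on with
    | _ n ih =>
    intro w hw hne hs
    have hpair : ∀ u v k, w = u ++ k :: k :: v → False := by
      rintro u v k rfl
      by_cases h0 : u ++ v = []
      · rw [List.append_eq_nil_iff] at h0
        rw [h0.1, h0.2] at hs
        exact halt k k 1 one_ne_zero hs
      · refine ih _ ?_ (u ++ v) rfl h0 (hs.remove_pair symm total)
        rw [← hw]
        simp only [List.length_append, List.length_cons]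
        omega
    have hchain : w.IsChain (· ≠ ·) := by
      rw [List.isChain_iff_forall_rel_of_append_cons_cons]
      rintro a b l₁ l₂ hl rfl
      exact hpair _ _ _ hl
    obtain ⟨a, u, rfl⟩ := List.exists_cons_of_ne_nil hne
    obtain ⟨m, hm | hm⟩ := exists_eq_alternating hchain
    · rw [hm] at hs
      refine halt a a.rev m ?_ hs
      rintro rfl
      exact hne hm
    · rcases m with _ | m
      · -- the square of the letter `a` is the alternating word `a a`
        rw [hm] at hs
        have h2 := hs.power 2
        exact halt a a 1 one_ne_zero h2
      · -- the word begins and ends with `a`: after a rotation, it has two equal neighbours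
        rw [alternating_succ_shift] at hm
        rw [hm] at hs
        have hs' : Splits R ([a] ++ (a.rev :: (alternating a a.rev m ++ [a]))) := hs
        have h2 := hs'.rotate total
        have h3 : Splits R ((a.rev :: alternating a a.rev m) ++ a :: a :: []) := by
          simpa using h2
        refine ih _ ?_ _ rfl ?_ (h3.remove_pair symm total)
        · rw [← hw, hm]
          simp
        · simp
  exact fun w => hlen _ w rfl

/-- For two undirected graphs, all sufficiently long words are scrambling as soon as, for each of
the three pairs of letters, some word `a b a b ⋯ a` is. -/
theorem exists_length_forall_scrambling_of_pairs [Finite α] {R : Fin 2 → α → α → Prop}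
    (symm : ∀ k i j, R k i j → R k j i) (total : ∀ k i, ∃ j, R k i j)
    (h : ∀ a b, a ≤ b → ∃ N, Scrambling R (a :: alternating b a N)) :
    ∃ L, ∀ w : List (Fin 2), w.length = L → Scrambling R w := by
  refine exists_length_forall_scrambling total (not_splits_of_alternating symm total ?_)
  intro a b
  rcases le_total a b with hab | hab
  · obtain ⟨N, hN⟩ := h a b hab
    refine ⟨N + 1, ?_⟩
    rw [alternating_succ_shift]
    exact hN.append_right total [b]
  · obtain ⟨N, hN⟩ := h b a hab
    refine ⟨N + 1, ?_⟩
    rw [alternating_succ]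
    exact hN.append_left total [a]

end TwoLetters

/-! ### Products of stochastic matrices -/

section Stochastic

variable {ι : Type*} {n : ℕ} {A : ι → Matrix (Fin n) (Fin n) ℝ}

/-- The graphs of the matrices: there is an edge `k` from `i` to `j` if `(A k) i j > 0`. -/
def Edge (A : ι → Matrix (Fin n) (Fin n) ℝ) (k : ι) (i j : Fin n) : Prop :=
  0 < A k i j

theorem exists_edge (hA : ∀ k, A k ∈ Matrix.rowStochastic ℝ (Fin n)) (k : ι) (i : Fin n) :
    ∃ j, Edge A k i j := by
  by_contra! h
  have h0 : ∑ j, A k i j ≤ 0 := Finset.sum_nonpos fun j _ => not_lt.1 (h j)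
  rw [Matrix.sum_row_of_mem_rowStochastic (hA k) i] at h0
  exact absurd h0 (by norm_num)

/-- The product of the matrices along a word. -/
def wordProd (A : ι → Matrix (Fin n) (Fin n) ℝ) (w : List ι) : Matrix (Fin n) (Fin n) ℝ :=
  (w.map A).prod

theorem wordProd_mem (hA : ∀ k, A k ∈ Matrix.rowStochastic ℝ (Fin n)) (w : List ι) :
    wordProd A w ∈ Matrix.rowStochastic ℝ (Fin n) := by
  refine Submonoid.list_prod_mem _ fun M hM => ?_
  obtain ⟨k, _, rfl⟩ := List.mem_map.1 hM
  exact hA k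

theorem wordProd_cons_apply (k : ι) (w : List ι) (i j : Fin n) :
    wordProd A (k :: w) i j = ∑ m, A k i m * wordProd A w m j := by
  simp [wordProd, Matrix.mul_apply]

theorem wordProd_pos_iff (hA : ∀ k, A k ∈ Matrix.rowStochastic ℝ (Fin n)) (w : List ι)
    (i j : Fin n) : 0 < wordProd A w i j ↔ Reach (Edge A) w i j := by
  induction w generalizing i with
  | nil =>
    by_cases h : i = j <;> simp [wordProd, Reach, h]
  | cons k w ih =>
    have h1 : ∀ m, 0 ≤ A k i m * wordProd A w m j := fun m =>
      mul_nonneg (Matrix.nonneg_of_mem_rowStochastic (hA k))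
        (Matrix.nonneg_of_mem_rowStochastic (wordProd_mem hA w))
    rw [wordProd_cons_apply, Finset.sum_pos_iff_of_nonneg fun m _ => h1 m]
    simp only [Finset.mem_univ, true_and, Reach, ← ih, Edge]
    refine exists_congr fun m => ⟨fun h => ?_, fun h => mul_pos h.1 h.2⟩
    exact ⟨pos_of_mul_pos_left h (Matrix.nonneg_of_mem_rowStochastic (wordProd_mem hA w)),
      pos_of_mul_pos_right h (Matrix.nonneg_of_mem_rowStochastic (hA k))⟩

theorem exists_pos_le_entries [Finite ι] (A : ι → Matrix (Fin n) (Fin n) ℝ) :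
    ∃ δ : ℝ, 0 < δ ∧ δ ≤ 1 ∧ ∀ k i j, 0 < A k i j → δ ≤ A k i j := by
  classical
  let f : Option (ι × Fin n × Fin n) → ℝ
    | none => 1
    | some (k, i, j) => if 0 < A k i j then A k i j else 1
  obtain ⟨o, ho⟩ := Finite.exists_min f
  refine ⟨f o, ?_, ho none, fun k i j h => ?_⟩
  · rcases o with _ | ⟨k, i, j⟩
    · exact one_pos
    · simp only [f]
      split_ifs with h
      · exact h
      · exact one_pos
  · have := ho (some (k, i, j))
    simpa only [f, if_pos h] using this

theorem pow_le_wordProd (hA : ∀ k, A k ∈ Matrix.rowStochastic ℝ (Fin n)) {δ : ℝ} (h0 : 0 ≤ δ)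
    (hδ : ∀ k i j, 0 < A k i j → δ ≤ A k i j) {w : List ι} {i j : Fin n}
    (h : Reach (Edge A) w i j) : δ ^ w.length ≤ wordProd A w i j := by
  induction w generalizing i with
  | nil =>
    obtain rfl : i = j := h
    simp [wordProd]
  | cons k w ih =>
    obtain ⟨m, h1, h2⟩ := h
    rw [wordProd_cons_apply, List.length_cons, pow_succ, mul_comm]
    refine (mul_le_mul (hδ k i m h1) (ih h2) (pow_nonneg h0 _)
      (Matrix.nonneg_of_mem_rowStochastic (hA k))).trans ?_
    exact Finset.single_le_sum (f := fun m => A k i m * wordProd A w m j) (fun l _ =>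
      mul_nonneg (Matrix.nonneg_of_mem_rowStochastic (hA k))
        (Matrix.nonneg_of_mem_rowStochastic (wordProd_mem hA w))) (Finset.mem_univ m)

/-- The letters `σ t, …, σ (t + L - 1)`, the last one first: the word of the matrix that takes
`x t` to `x (t + L)`. -/
def blockWord (σ : ℕ → ι) (t : ℕ) : ℕ → List ι
  | 0 => []
  | L + 1 => σ (t + L) :: blockWord σ t L

theorem length_blockWord (σ : ℕ → ι) (t L : ℕ) : (blockWord σ t L).length = L := by
  induction L with
  | zero => rfl
  | succ L ih => rw [blockWord, List.length_cons, ih]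

theorem trajectory_add (A : ι → Matrix (Fin n) (Fin n) ℝ) (σ : ℕ → ι) (x₀ : Fin n → ℝ)
    (t L : ℕ) : trajectory A σ x₀ (t + L) =
      (wordProd A (blockWord σ t L)).mulVec (trajectory A σ x₀ t) := by
  induction L with
  | zero => simp [blockWord, wordProd]
  | succ L ih =>
    rw [← add_assoc, trajectory, ih, Matrix.mulVec_mulVec]
    simp [blockWord, wordProd]

/-! ### Scrambling words contract -/

theorem mulVec_le {P : Matrix (Fin n) (Fin n) ℝ} (hP : P ∈ Matrix.rowStochastic ℝ (Fin n))
    {x : Fin n → ℝ} {b : ℝ} (hb : ∀ i, x i ≤ b) (i l : Fin n) :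
    P.mulVec x i ≤ b - P i l * (b - x l) := by
  have h1 : b - P.mulVec x i = ∑ m, P i m * (b - x m) := by
    simp only [Matrix.mulVec, dotProduct, mul_sub, Finset.sum_sub_distrib, ← Finset.sum_mul,
      Matrix.sum_row_of_mem_rowStochastic hP i, one_mul]
  have h2 : P i l * (b - x l) ≤ ∑ m, P i m * (b - x m) :=
    Finset.single_le_sum (f := fun m => P i m * (b - x m)) (fun m _ =>
      mul_nonneg (Matrix.nonneg_of_mem_rowStochastic hP) (sub_nonneg.2 (hb m)))
      (Finset.mem_univ l)
  linarith

theorem le_mulVec {P : Matrix (Fin n) (Fin n) ℝ} (hP : P ∈ Matrix.rowStochastic ℝ (Fin n))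
    {x : Fin n → ℝ} {a : ℝ} (ha : ∀ i, a ≤ x i) (i l : Fin n) :
    a + P i l * (x l - a) ≤ P.mulVec x i := by
  have h := mulVec_le hP (x := -x) (b := -a) (fun i => neg_le_neg (ha i)) i l
  rw [Matrix.mulVec_neg, Pi.neg_apply, Pi.neg_apply] at h
  linarith

/-- Dobrushin's contraction of the spread of the coordinates. -/
theorem mulVec_sub_le {P : Matrix (Fin n) (Fin n) ℝ} (hP : P ∈ Matrix.rowStochastic ℝ (Fin n))
    {x : Fin n → ℝ} {a b δ : ℝ} (ha : ∀ i, a ≤ x i) (hb : ∀ i, x i ≤ b) {i j l : Fin n}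
    (hi : δ ≤ P i l) (hj : δ ≤ P j l) :
    P.mulVec x i - P.mulVec x j ≤ (1 - δ) * (b - a) := by
  have h1 := mulVec_le hP hb i l
  have h2 := le_mulVec hP ha j l
  have h3 := mul_le_mul_of_nonneg_right hi (sub_nonneg.2 (hb l))
  have h4 := mul_le_mul_of_nonneg_right hj (sub_nonneg.2 (ha l))
  linarith

theorem asymptoticallyStable_of_scrambling [Finite ι]
    (hA : ∀ k, A k ∈ Matrix.rowStochastic ℝ (Fin n)) {L : ℕ}
    (h : ∀ w : List ι, w.length = L → Scrambling (Edge A) w) : AsymptoticallyStable A := by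
  intro x₀ σ
  rcases isEmpty_or_nonempty (Fin n) with hn | hn
  · exact ⟨0, tendsto_const_nhds.congr fun _ => Subsingleton.elim _ _⟩
  obtain ⟨δ, h0, h1, hδ⟩ := exists_pos_le_entries A
  set x := trajectory A σ x₀ with hx
  let hi : ℕ → ℝ := fun t => ⨆ i, x t i
  let lo : ℕ → ℝ := fun t => ⨅ i, x t i
  have le_hi : ∀ t i, x t i ≤ hi t := fun t i => le_ciSup (Set.finite_range (x t)).bddAbove i
  have lo_le : ∀ t i, lo t ≤ x t i := fun t i => ciInf_le (Set.finite_range (x t)).bddBelow i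
  have step : ∀ t, x (t + 1) = (A (σ t)).mulVec (x t) := fun t => rfl
  have hi_anti : Antitone hi := by
    refine antitone_nat_of_succ_le fun t => ciSup_le fun i => ?_
    rw [step]
    refine (mulVec_le (hA _) (le_hi t) i i).trans (sub_le_self _ ?_)
    exact mul_nonneg (Matrix.nonneg_of_mem_rowStochastic (hA _)) (sub_nonneg.2 (le_hi t i))
  have lo_mono : Monotone lo := by
    refine monotone_nat_of_le_succ fun t => le_ciInf fun i => ?_
    rw [step]
    refine le_trans (le_add_of_nonneg_right ?_) (le_mulVec (hA _) (lo_le t) i i)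
    exact mul_nonneg (Matrix.nonneg_of_mem_rowStochastic (hA _)) (sub_nonneg.2 (lo_le t i))
  have lo_le_hi : ∀ t, lo t ≤ hi t := fun t =>
    (lo_le t (Classical.arbitrary _)).trans (le_hi t (Classical.arbitrary _))
  have block : ∀ t, hi (t + L) - lo (t + L) ≤ (1 - δ ^ L) * (hi t - lo t) := by
    intro t
    rw [sub_le_iff_le_add]
    refine ciSup_le fun i => ?_
    rw [← sub_le_iff_le_add']
    refine le_ciInf fun j => ?_
    rw [sub_le_comm, hx, trajectory_add]
    obtain ⟨l, hl, hl'⟩ := h _ (length_blockWord σ t L) i j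
    have e1 := pow_le_wordProd hA h0.le hδ hl
    have e2 := pow_le_wordProd hA h0.le hδ hl'
    rw [length_blockWord] at e1 e2
    exact mulVec_sub_le (wordProd_mem hA _) (lo_le t) (le_hi t) e1 e2
  have hq0 : 0 ≤ 1 - δ ^ L := sub_nonneg.2 (pow_le_one₀ h0.le h1)
  have hq1 : 1 - δ ^ L < 1 := sub_lt_self _ (pow_pos h0 L)
  have blocks : ∀ m, hi (m * L) - lo (m * L) ≤ (1 - δ ^ L) ^ m * (hi 0 - lo 0) := by
    intro m
    induction m with
    | zero => simp
    | succ m ih =>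
      rw [Nat.succ_mul, pow_succ', mul_assoc]
      exact (block _).trans (mul_le_mul_of_nonneg_left ih hq0)
  have hzero : Tendsto (fun t => hi t - lo t) atTop (𝓝 0) := by
    have hlim : Tendsto (fun m : ℕ => (1 - δ ^ L) ^ m * (hi 0 - lo 0)) atTop (𝓝 0) := by
      simpa using (tendsto_pow_atTop_nhds_zero_of_lt_one hq0 hq1).mul_const (hi 0 - lo 0)
    rw [Metric.tendsto_atTop]
    intro ε hε
    obtain ⟨m, hm⟩ := (hlim.eventually (gt_mem_nhds hε)).exists
    refine ⟨m * L, fun t ht => ?_⟩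
    rw [Real.dist_eq, sub_zero, abs_of_nonneg (sub_nonneg.2 (lo_le_hi t))]
    exact (sub_le_sub (hi_anti ht) (lo_mono ht)).trans_lt ((blocks m).trans_lt hm)
  have hbdd : BddBelow (Set.range hi) :=
    ⟨lo 0, by rintro _ ⟨t, rfl⟩; exact (lo_mono (Nat.zero_le t)).trans (lo_le_hi t)⟩
  have hhi := tendsto_atTop_ciInf hi_anti hbdd
  have hlo : Tendsto lo atTop (𝓝 (⨅ t, hi t)) := by
    have := hhi.sub hzero
    simpa using this
  refine ⟨⨅ t, hi t, tendsto_pi_nhds.2 fun i => ?_⟩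
  simp only [Pi.smul_apply, Pi.one_apply, smul_eq_mul, mul_one]
  exact tendsto_of_tendsto_of_tendsto_of_le_of_le hlo hhi (fun t => lo_le t i) (fun t => le_hi t i)

/-! ### Stability along alternating sequences -/

/-- In a stable system, the supports of two rows of the powers of the product `A b * A a` cannot
remain disjoint: the powers would converge to a matrix with equal rows, whose square of each entry
would be zero, while the rows have sum one. -/
theorem AsymptoticallyStable.exists_common (hA : ∀ k, A k ∈ Matrix.rowStochastic ℝ (Fin n))
    (h : AsymptoticallyStable A) (a b : ι) (p q : Fin n) :
    ∃ t l, Reach (Edge A) (alternating b a t) p l ∧ Reach (Edge A) (alternating b a t) q l := by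
  by_contra! hdis
  let σ : ℕ → ι := fun t => if Even t then a else b
  have hword : ∀ t, blockWord σ 0 (2 * t) = alternating b a t := by
    intro t
    induction t with
    | zero => rfl
    | succ t ih =>
      rw [Nat.mul_succ, blockWord, blockWord, ih, alternating_succ]
      simp [σ]
  choose c hc using fun j : Fin n => h (Pi.single j 1) σ
  have hlim : ∀ i j, Tendsto (fun t => wordProd A (alternating b a t) i j) atTop (𝓝 (c j)) := by
    intro i j
    have h1 := (tendsto_pi_nhds.1 (hc j) i).comp
      (tendsto_id.const_mul_atTop' (two_pos : 0 < 2))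
    simp only [Pi.smul_apply, Pi.one_apply, smul_eq_mul, mul_one] at h1
    refine h1.congr fun t => ?_
    have h2 := trajectory_add A σ (Pi.single j 1) 0 (2 * t)
    rw [zero_add, hword, trajectory, Matrix.mulVec_single_one] at h2
    simp only [Function.comp_apply, id_eq]
    rw [h2]
    rfl
  have hc0 : ∀ j, c j = 0 := by
    intro j
    have h1 := (hlim p j).mul (hlim q j)
    have h2 : ∀ t, wordProd A (alternating b a t) p j * wordProd A (alternating b a t) q j = 0 := by
      intro t
      have np := Matrix.nonneg_of_mem_rowStochastic (wordProd_mem hA (alternating b a t))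
        (i := p) (j := j)
      have nq := Matrix.nonneg_of_mem_rowStochastic (wordProd_mem hA (alternating b a t))
        (i := q) (j := j)
      by_contra hne
      rw [mul_eq_zero, not_or] at hne
      exact hdis t j ((wordProd_pos_iff hA _ _ _).1 (np.lt_of_ne' hne.1))
        ((wordProd_pos_iff hA _ _ _).1 (nq.lt_of_ne' hne.2))
    simp only [h2] at h1
    exact mul_self_eq_zero.1 (tendsto_nhds_unique h1 tendsto_const_nhds)
  have hsum : Tendsto (fun t => ∑ j, wordProd A (alternating b a t) p j) atTop
      (𝓝 (∑ j, c j)) := tendsto_finsetSum _ fun j _ => hlim p j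
  simp only [Matrix.sum_row_of_mem_rowStochastic (wordProd_mem hA _), hc0,
    Finset.sum_const_zero] at hsum
  exact one_ne_zero (tendsto_nhds_unique hsum tendsto_const_nhds).symm

/-- If two points have a common end point along a power of the word `b a`, then along the `N`-th
power for every `N ≥ n²`: the sets of such pairs increase with the exponent, and each of them
determines the next. -/
theorem reach_alternating_of_le {α : Type*} [Fintype α] {R : ι → α → α → Prop}
    (total : ∀ k i, ∃ j, R k i j) {a b : ι} {N t : ℕ}
    (hN : Fintype.card α * Fintype.card α ≤ N) {p q l : α}
    (hp : Reach R (alternating b a t) p l) (hq : Reach R (alternating b a t) q l) :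
    ∃ l, Reach R (alternating b a N) p l ∧ Reach R (alternating b a N) q l := by
  let C : ℕ → Set (α × α) := fun s =>
    {x | ∃ l, Reach R (alternating b a s) x.1 l ∧ Reach R (alternating b a s) x.2 l}
  have hmono : Monotone C := by
    refine monotone_nat_of_le_succ fun s => ?_
    rintro ⟨i, j⟩ ⟨l, h1, h2⟩
    obtain ⟨m, hm⟩ := exists_reach total (alternating b a 1) l
    refine ⟨m, ?_, ?_⟩
    · rw [alternating_add]
      exact reach_append.2 ⟨l, h1, hm⟩
    · rw [alternating_add]
      exact reach_append.2 ⟨l, h2, hm⟩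
  have hnext : ∀ s x, x ∈ C (s + 1) ↔
      ∃ y ∈ C s, Reach R [b, a] x.1 y.1 ∧ Reach R [b, a] x.2 y.2 := by
    rintro s ⟨i, j⟩
    have e : alternating b a (s + 1) = [b, a] ++ alternating b a s := alternating_succ _ _ _
    simp only [C, Set.mem_ofPred_eq, e, reach_append]
    constructor
    · rintro ⟨l, ⟨m, h1, h2⟩, ⟨m', h1', h2'⟩⟩
      exact ⟨(m, m'), ⟨l, h2, h2'⟩, h1, h1'⟩
    · rintro ⟨⟨m, m'⟩, ⟨l, h2, h2'⟩, h1, h1'⟩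
      exact ⟨l, ⟨m, h1, h2⟩, ⟨m', h1', h2'⟩⟩
  have hstab : ∀ s, C s = C (s + 1) → C (s + 1) = C (s + 2) := by
    intro s hs
    ext x
    rw [hnext, hnext (s + 1), hs]
  have hcard : ∀ s s', s ≤ s' → (C s).ncard = (C s').ncard → C s = C s' := fun s s' hss h =>
    Set.eq_of_subset_of_ncard_le (hmono hss) h.ge (Set.toFinite _)
  have hconst : ∀ M, Fintype.card α * Fintype.card α ≤ M →
      (C M).ncard = (C (Fintype.card α * Fintype.card α)).ncard := by
    intro M hM
    refine Nat.stabilises_of_monotone (f := fun s => (C s).ncard)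
      (fun s s' hss => Set.ncard_le_ncard (hmono hss) (Set.toFinite _)) (fun s => ?_)
      (fun s hs => ?_) hM
    · rw [← Fintype.card_prod, ← Nat.card_eq_fintype_card, ← Set.ncard_univ]
      exact Set.ncard_le_ncard (Set.subset_univ _) (Set.toFinite _)
    · exact congrArg Set.ncard (hstab s (hcard _ _ (Nat.le_succ s) hs))
  have hlast : C N = C (max t N) := by
    refine hcard _ _ (le_max_right _ _) ?_
    rw [hconst N hN, hconst _ (hN.trans (le_max_right _ _))]
  have hmem : (p, q) ∈ C N := by
    rw [hlast]
    exact hmono (le_max_left _ _) ⟨l, hp, hq⟩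
  exact hmem

/-- The combinatorial criterion: for each of the pairs of letters `a ≤ b`, every `i` and `j` have a
common end point along `a b a b ⋯ a` and `b a b a ⋯ a`, respectively. -/
theorem asymptoticallyStable_iff {A : Fin 2 → Matrix (Fin n) (Fin n) ℝ}
    (hA : ∀ k, A k ∈ Matrix.rowStochastic ℝ (Fin n))
    (symm : ∀ k i j, Edge A k i j → Edge A k j i) {N : ℕ} (hN : n * n ≤ N) :
    AsymptoticallyStable A ↔ ∀ a b, a ≤ b → ∀ i j, ∃ l,
      Reach (Edge A) (a :: alternating b a N) i l ∧ Reach (Edge A) (alternating b a N) j l := by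
  have total := exists_edge hA
  constructor
  · intro h a b _ i j
    obtain ⟨m, hm⟩ := total a i
    obtain ⟨t, l, h1, h2⟩ := h.exists_common hA a b m j
    obtain ⟨l', h1', h2'⟩ :=
      reach_alternating_of_le total (N := N) (by simpa using hN) h1 h2
    exact ⟨l', ⟨m, hm, h1'⟩, h2'⟩
  · intro h
    have hscr : ∀ a b, a ≤ b → ∃ N, Scrambling (Edge A) (a :: alternating b a N) := by
      intro a b hab
      refine ⟨N, fun i j => ?_⟩
      obtain ⟨m, hm⟩ := total a j
      obtain ⟨l, h1, h2⟩ := h a b hab i m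
      exact ⟨l, h1, m, hm, h2⟩
    obtain ⟨L, hL⟩ := exists_length_forall_scrambling_of_pairs symm total hscr
    exact asymptoticallyStable_of_scrambling hA hL

end Stochastic

/-! ### Structured programs for stack machines -/

section Programs

variable {K : Type} {Γ : K → Type} {S : Type}

/-- Structured programs over stacks with alphabets `Γ k` and registers with values in `S`. The
program `loop k f p` pops symbols from the stack `k` until it is empty, and after each popped symbol
`a` it replaces the registers `s` by `f s a` and runs `p`. -/
inductive Prog (Γ : K → Type) (S : Type) : Type
  | pop (k : K) (f : S → Option (Γ k) → S)
  | push (k : K) (f : S → Γ k)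
  | load (f : S → S)
  | seq (p q : Prog Γ S)
  | ite (c : S → Bool) (p q : Prog Γ S)
  | loop (k : K) (f : S → Γ k → S) (p : Prog Γ S)

namespace Prog

/-- The labels of the machine code of a program. -/
def Label : Prog Γ S → Type
  | pop _ _ => Unit
  | push _ _ => Unit
  | load _ => Unit
  | seq p q => p.Label ⊕ q.Label
  | ite _ p q => Option (p.Label ⊕ q.Label)
  | loop _ _ p => Option p.Label

theorem finite_label (p : Prog Γ S) : Finite p.Label := by
  induction p with
  | pop | push | load => exact inferInstanceAs (Finite Unit)
  | seq p q hp hq => exact inferInstanceAs (Finite (p.Label ⊕ q.Label))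
  | ite c p q hp hq => exact inferInstanceAs (Finite (Option (p.Label ⊕ q.Label)))
  | loop k f p hp => exact inferInstanceAs (Finite (Option p.Label))

/-- The label at which the machine code of a program is entered. -/
def entry : (p : Prog Γ S) → p.Label
  | pop _ _ => ()
  | push _ _ => ()
  | load _ => ()
  | seq p _ => Sum.inl p.entry
  | ite _ _ _ => none
  | loop _ _ _ => none

open Turing.TM2 in
/-- The machine code of a program, inside a machine with labels in `Λ`: `emb` places the labels of
the program, and `exit` is the label to go to when the program has finished. The machine has one
Boolean register more than the program, in which the test of a loop stores whether its stack was
nonempty; it is `false` whenever a label is reached. -/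
def code {Λ : Type} : (p : Prog Γ S) → (p.Label → Λ) → Λ → p.Label → Stmt Γ Λ (S × Bool)
  | pop k f, _, exit, _ => .pop k (fun s o => (f s.1 o, false)) (.goto fun _ => exit)
  | push k f, _, exit, _ => .push k (fun s => f s.1) (.goto fun _ => exit)
  | load f, _, exit, _ => .load (fun s => (f s.1, false)) (.goto fun _ => exit)
  | seq p q, emb, _, Sum.inl l =>
      p.code (fun l => emb (Sum.inl l)) (emb (Sum.inr q.entry)) l
  | seq _ q, emb, exit, Sum.inr l => q.code (fun l => emb (Sum.inr l)) exit l
  | ite c p q, emb, _, none =>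
      .branch (fun s => c s.1) (.goto fun _ => emb (some (Sum.inl p.entry)))
        (.goto fun _ => emb (some (Sum.inr q.entry)))
  | ite _ p _, emb, exit, some (Sum.inl l) => p.code (fun l => emb (some (Sum.inl l))) exit l
  | ite _ _ q, emb, exit, some (Sum.inr l) => q.code (fun l => emb (some (Sum.inr l))) exit l
  | loop k f p, emb, exit, none =>
      .pop k (fun s o => o.elim (s.1, false) fun a => (f s.1 a, true))
        (.branch (fun s => s.2)
          (.load (fun s => (s.1, false)) (.goto fun _ => emb (some p.entry)))
          (.goto fun _ => exit))
  | loop _ _ p, emb, _, some l => p.code (fun l => emb (some l)) (emb none) l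

variable [DecidableEq K]

/-- `Exec p (s, T) (s', T') t`: started with registers `s` and stacks `T`, the program `p` finishes
with registers `s'` and stacks `T'` in time at most `t`. -/
inductive Exec : Prog Γ S → S × (∀ k, List (Γ k)) → S × (∀ k, List (Γ k)) → ℕ → Prop
  | pop (k f s T) :
      Exec (pop k f) (s, T) (f s (T k).head?, Function.update T k (T k).tail) 1
  | push (k f s T) : Exec (push k f) (s, T) (s, Function.update T k (f s :: T k)) 1
  | load (f s T) : Exec (load f) (s, T) (f s, T) 1
  | seq {p q c₁ c₂ c₃ t₁ t₂} : Exec p c₁ c₂ t₁ → Exec q c₂ c₃ t₂ →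
      Exec (seq p q) c₁ c₃ (t₁ + t₂)
  | ite_true {b p q c₁ c₂ t} : b c₁.1 = true → Exec p c₁ c₂ t → Exec (ite b p q) c₁ c₂ (t + 1)
  | ite_false {b p q c₁ c₂ t} : b c₁.1 = false → Exec q c₁ c₂ t → Exec (ite b p q) c₁ c₂ (t + 1)
  | loop_nil {k f p s T} : T k = [] → Exec (loop k f p) (s, T) (s, T) 1
  | loop_cons {k f p s T a l c₂ c₃ t₁ t₂} : T k = a :: l →
      Exec p (f s a, Function.update T k l) c₂ t₁ → Exec (loop k f p) c₂ c₃ t₂ →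
      Exec (loop k f p) (s, T) c₃ (1 + t₁ + t₂)
  | mono {p c₁ c₂ t₁ t₂} : Exec p c₁ c₂ t₁ → t₁ ≤ t₂ → Exec p c₁ c₂ t₂

open Turing StateTransition

theorem evalsToInTime_trans {σ : Type*} {f : σ → Option σ} {m₁ m₂ : ℕ} {a b : σ} {c : Option σ}
    (h₁ : Nonempty (EvalsToInTime f a (some b) m₁)) (h₂ : Nonempty (EvalsToInTime f b c m₂)) :
    Nonempty (EvalsToInTime f a c (m₁ + m₂)) :=
  h₁.elim fun h₁ => h₂.elim fun h₂ => ⟨add_comm m₂ m₁ ▸ EvalsToInTime.trans f m₁ m₂ a b c h₁ h₂⟩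

theorem evalsToInTime_mono {σ : Type*} {f : σ → Option σ} {m₁ m₂ : ℕ} {a : σ} {c : Option σ}
    (h : Nonempty (EvalsToInTime f a c m₁)) (hm : m₁ ≤ m₂) :
    Nonempty (EvalsToInTime f a c m₂) :=
  h.elim fun h => ⟨⟨h.toEvalsTo, h.steps_le_m.trans hm⟩⟩

theorem evalsToInTime_one {σ : Type*} {f : σ → Option σ} {a : σ} {c : Option σ}
    (h : f a = c) : Nonempty (EvalsToInTime f a c 1) :=
  ⟨⟨⟨1, h⟩, le_rfl⟩⟩

/-- The machine code of a program does what the program does, within the same time. -/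
theorem Exec.evalsTo {p : Prog Γ S} {c c' : S × (∀ k, List (Γ k))} {t : ℕ} (h : Exec p c c' t)
    {Λ : Type} (M : Λ → TM2.Stmt Γ Λ (S × Bool)) (emb : p.Label → Λ) (exit : Λ)
    (hM : ∀ l, M (emb l) = p.code emb exit l) :
    Nonempty (EvalsToInTime (TM2.step M) ⟨some (emb p.entry), (c.1, false), c.2⟩
      (some ⟨some exit, (c'.1, false), c'.2⟩) t) := by
  induction h generalizing Λ with
  | pop k f s T => exact evalsToInTime_one (by simp [TM2.step, hM, code])
  | push k f s T => exact evalsToInTime_one (by simp [TM2.step, hM, code])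
  | load f s T => exact evalsToInTime_one (by simp [TM2.step, hM, code])
  | seq _ _ ih₁ ih₂ =>
    exact evalsToInTime_trans (ih₁ M (fun l => emb (Sum.inl l)) _ fun l => hM (Sum.inl l))
      (ih₂ M (fun l => emb (Sum.inr l)) _ fun l => hM (Sum.inr l))
  | ite_true hb _ ih =>
    rw [add_comm]
    exact evalsToInTime_trans (evalsToInTime_one (by rw [TM2.step, hM]; simp [code, entry, hb]))
      (ih M (fun l => emb (some (Sum.inl l))) _ fun l => hM (some (Sum.inl l)))
  | ite_false hb _ ih =>
    rw [add_comm]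
    exact evalsToInTime_trans (evalsToInTime_one (by rw [TM2.step, hM]; simp [code, entry, hb]))
      (ih M (fun l => emb (some (Sum.inr l))) _ fun l => hM (some (Sum.inr l)))
  | @loop_nil k _ _ _ T hT =>
    have hT' : Function.update T k [] = T := by rw [← hT, Function.update_eq_self]
    exact evalsToInTime_one (by rw [TM2.step, hM]; simp [code, entry, hT, hT'])
  | loop_cons hT _ _ ih₁ ih₂ =>
    exact evalsToInTime_trans (evalsToInTime_trans
      (evalsToInTime_one (by rw [TM2.step, hM]; simp [code, entry, hT]))
      (ih₁ M (fun l => emb (some l)) _ fun l => hM (some l))) (ih₂ M emb _ hM)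
  | mono _ ht ih => exact evalsToInTime_mono (ih M emb exit hM) ht

/-- The machine of a program. -/
noncomputable def machine [Fintype K] [Fintype S] (p : Prog Γ S) (k₀ k₁ : K) [Fintype (Γ k₀)]
    (s₀ : S) : FinTM2 where
  K := K
  k₀ := k₀
  k₁ := k₁
  Γ := Γ
  Λ := Option p.Label
  main := some p.entry
  ΛFin := letI := p.finite_label; Fintype.ofFinite _
  σ := S × Bool
  initialState := (s₀, false)
  m := fun l => l.elim TM2.Stmt.halt (p.code some none)

theorem Exec.outputs [Fintype K] [Fintype S] {p : Prog Γ S} {k₀ k₁ : K} [Fintype (Γ k₀)] {s₀ : S}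
    {v : List (Γ k₀)} {w : List (Γ k₁)} {t : ℕ}
    (h : Exec p (s₀, Function.update (fun _ => []) k₀ v) (s₀, Function.update (fun _ => []) k₁ w)
      t) : Nonempty (TM2OutputsInTime (p.machine k₀ k₁ s₀) v (some w) (t + 1)) := by
  have stk : ∀ (k₀ : K) (v : List (Γ k₀)),
      (fun k => @dite (List (Γ k)) (k = k₀) (by infer_instance) (fun h => by rw [h]; exact v)
        fun _ => []) = Function.update (fun _ => []) k₀ v := by
    intro k₀ v
    funext k
    by_cases hk : k = k₀
    · subst hk
      simp
    · simp [hk]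
  have h1 := h.evalsTo (Λ := Option p.Label) (p.machine k₀ k₁ s₀).m some none fun _ => rfl
  have h2 := evalsToInTime_trans h1 (evalsToInTime_one (c := some
    ⟨none, (s₀, false), Function.update (fun _ => []) k₁ w⟩) rfl)
  have e1 : initList (p.machine k₀ k₁ s₀) v =
      ⟨some (some p.entry), (s₀, false), Function.update (fun _ => []) k₀ v⟩ :=
    congrArg (TM2.Cfg.mk _ _) (stk k₀ v)
  have e2 : haltList (p.machine k₀ k₁ s₀) w =
      ⟨none, (s₀, false), Function.update (fun _ => []) k₁ w⟩ :=
    congrArg (TM2.Cfg.mk _ _) (stk k₁ w)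
  change Nonempty (EvalsToInTime _ (initList (p.machine k₀ k₁ s₀) v)
    (some (haltList (p.machine k₀ k₁ s₀) w)) _)
  rw [e1, e2]
  exact h2

end Prog

end Programs

/-! ### Boolean matrices as lists of rows -/

/-- The Boolean scalar product. -/
def boolDot : List Bool → List Bool → Bool
  | a :: u, b :: v => (a && b) || boolDot u v
  | _, _ => false

/-- The Boolean product of `M` and the transpose of `X`, for matrices given by their rows. -/
def mulTranspose (M X : List (List Bool)) : List (List Bool) :=
  M.map fun v => X.map fun u => boolDot v u

/-- A matrix as the content of a stack: its rows, each followed by `none`. -/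
def rowsCode (M : List (List Bool)) : List (Option Bool) :=
  M.flatMap fun r => r.map some ++ [none]

theorem rowsCode_cons (r : List Bool) (M : List (List Bool)) :
    rowsCode (r :: M) = r.map some ++ none :: rowsCode M := by
  simp [rowsCode]

/-- The matrix given by the rows has size `n × n`. -/
def IsSquare (n : ℕ) (M : List (List Bool)) : Prop :=
  M.length = n ∧ ∀ r ∈ M, r.length = n

theorem length_rowsCode {n : ℕ} {M : List (List Bool)} (h : ∀ r ∈ M, r.length = n) :
    (rowsCode M).length = M.length * (n + 1) := by
  induction M with
  | nil => simp [rowsCode]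
  | cons r M ih =>
    rw [List.forall_mem_cons] at h
    rw [rowsCode_cons, List.length_append, List.length_cons, ih h.2, List.length_map, h.1,
      List.length_cons]
    ring

theorem IsSquare.length_rowsCode {n : ℕ} {M : List (List Bool)} (h : IsSquare n M) :
    (rowsCode M).length = n * (n + 1) := by
  rw [Consensus.length_rowsCode h.2, h.1]

theorem IsSquare.mulTranspose {n : ℕ} {M X : List (List Bool)} (hM : IsSquare n M)
    (hX : IsSquare n X) : IsSquare n (mulTranspose M X) := by
  refine ⟨by rw [Consensus.mulTranspose, List.length_map, hM.1], fun r hr => ?_⟩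
  obtain ⟨v, _, rfl⟩ := List.mem_map.1 hr
  rw [List.length_map, hX.1]

/-! ### The memory of the machine -/

/-- The work stacks: two matrices `mat`, with stacks `rev` to put their entries aside, two
counters `cnt`, the current matrix `x`, with a stack `x'` to put its entries aside, the next matrix
`y` under construction, and a row `r`, with a stack `r'` to put its entries aside. -/
inductive Work
  | mat (i : Fin 2)
  | rev (i : Fin 2)
  | cnt (i : Fin 2)
  | x
  | x'
  | y
  | r
  | r'
  deriving DecidableEq, Fintype

/-- The stacks of the machine. -/
inductive Stack
  | input
  | output
  | work (w : Work)
  deriving DecidableEq, Fintype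

/-- The alphabets of the stacks. -/
abbrev Alphabet : Stack → Type
  | .input => Letter
  | .output => Bool
  | .work _ => Option Bool

/-- The registers: the last letter read, the last symbols popped from work stacks, a partial
scalar product, the conjunction of the results so far, and, for reading the input, whether an entry
begins and to which matrix it belongs. -/
structure Reg where
  letter : Letter
  sym : Option Bool
  sym' : Option Bool
  acc : Bool
  ok : Bool
  start : Bool
  target : Fin 2

noncomputable instance : Fintype Reg :=
  Fintype.ofInjective
    (fun s : Reg => (s.letter, s.sym, s.sym', s.acc, s.ok, s.start, s.target)) fun s s' h => by
      cases s
      cases s'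
      simpa using h

/-- The contents of the work stacks. -/
@[ext]
structure Mem where
  mat : Fin 2 → List (Option Bool)
  rev : Fin 2 → List (Option Bool)
  cnt : Fin 2 → List (Option Bool)
  x : List (Option Bool)
  x' : List (Option Bool)
  y : List (Option Bool)
  r : List (Option Bool)
  r' : List (Option Bool)

namespace Mem

/-- The content of a work stack. -/
def get (μ : Mem) : Work → List (Option Bool)
  | .mat i => μ.mat i
  | .rev i => μ.rev i
  | .cnt i => μ.cnt i
  | .x => μ.x
  | .x' => μ.x'
  | .y => μ.y
  | .r => μ.r
  | .r' => μ.r'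

/-- The memory with the content of one stack replaced. -/
def set (μ : Mem) : Work → List (Option Bool) → Mem
  | .mat i, l => { μ with mat := Function.update μ.mat i l }
  | .rev i, l => { μ with rev := Function.update μ.rev i l }
  | .cnt i, l => { μ with cnt := Function.update μ.cnt i l }
  | .x, l => { μ with x := l }
  | .x', l => { μ with x' := l }
  | .y, l => { μ with y := l }
  | .r, l => { μ with r := l }
  | .r', l => { μ with r' := l }

theorem get_set (μ : Mem) (w : Work) (l : List (Option Bool)) :
    (μ.set w l).get = Function.update μ.get w l := by
  funext v
  cases w <;> cases v <;> simp [get, set, Function.update_apply]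

theorem get_injective : Function.Injective get := by
  intro μ ν h
  have h' := congrFun h
  ext1
  · exact funext fun i => h' (.mat i)
  · exact funext fun i => h' (.rev i)
  · exact funext fun i => h' (.cnt i)
  · exact h' .x
  · exact h' .x'
  · exact h' .y
  · exact h' .r
  · exact h' .r'

theorem set_set (μ : Mem) (w : Work) (l m : List (Option Bool)) :
    (μ.set w l).set w m = μ.set w m :=
  get_injective (by simp [get_set])

theorem set_get (μ : Mem) (w : Work) : μ.set w (μ.get w) = μ :=
  get_injective (by simp [get_set])

end Mem

/-- All the stacks of the machine. -/
def allStacks (v : List Letter) (o : List Bool) (μ : Mem) : ∀ k, List (Alphabet k)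
  | .input => v
  | .output => o
  | .work w => μ.get w

theorem update_allStacks_input (v u : List Letter) (o : List Bool) (μ : Mem) :
    Function.update (allStacks v o μ) .input u = allStacks u o μ := by
  funext k
  cases k
  · exact Function.update_self _ _ _
  · exact Function.update_of_ne (by simp) _ _
  · exact Function.update_of_ne (by simp) _ _

theorem update_allStacks_output (v : List Letter) (o u : List Bool) (μ : Mem) :
    Function.update (allStacks v o μ) .output u = allStacks v u μ := by
  funext k
  cases k
  · exact Function.update_of_ne (by simp) _ _
  · exact Function.update_self _ _ _
  · exact Function.update_of_ne (by simp) _ _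

theorem update_allStacks_work (v : List Letter) (o : List Bool) (μ : Mem) (w : Work)
    (l : List (Option Bool)) :
    Function.update (allStacks v o μ) (.work w) l = allStacks v o (μ.set w l) := by
  funext k
  rcases k with _ | _ | u
  · exact Function.update_of_ne (by simp) _ _
  · exact Function.update_of_ne (by simp) _ _
  · simp only [allStacks, Mem.get_set]
    by_cases h : u = w
    · subst h
      rw [Function.update_self, Function.update_self]
    · rw [Function.update_of_ne h]
      exact Function.update_of_ne (by simpa using h) _ _

/-- A configuration with empty output. -/
def cfg (v : List Letter) (s : Reg) (μ : Mem) : Reg × (∀ k, List (Alphabet k)) :=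
  (s, allStacks v [] μ)

/-! ### Programs on the work stacks -/

namespace Prog

theorem Exec.congr {K : Type} {Γ : K → Type} {S : Type} [DecidableEq K] {p : Prog Γ S}
    {c₁ c₂ c₃ : S × (∀ k, List (Γ k))} {t t' : ℕ} (h : Exec p c₁ c₂ t) (hc : c₂ = c₃)
    (ht : t ≤ t') : Exec p c₁ c₃ t' :=
  hc ▸ h.mono ht

theorem exec_pop (w : Work) (f : Reg → Option (Option Bool) → Reg) (v : List Letter) (s : Reg)
    (μ : Mem) : Exec (Γ := Alphabet) (pop (.work w) f) (cfg v s μ)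
      (cfg v (f s (μ.get w).head?) (μ.set w (μ.get w).tail)) 1 := by
  exact (Exec.pop (Γ := Alphabet) (.work w) f s (allStacks v [] μ)).congr
    (congrArg (Prod.mk _) (update_allStacks_work _ _ _ _ _)) le_rfl

theorem exec_push (w : Work) (f : Reg → Option Bool) (v : List Letter) (s : Reg) (μ : Mem) :
    Exec (Γ := Alphabet) (push (.work w) f) (cfg v s μ)
      (cfg v s (μ.set w (f s :: μ.get w))) 1 := by
  exact (Exec.push (Γ := Alphabet) (.work w) f s (allStacks v [] μ)).congr
    (congrArg (Prod.mk _) (update_allStacks_work _ _ _ _ _)) le_rfl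

theorem exec_loop_nil {w : Work} {f : Reg → Option Bool → Reg} {p : Prog Alphabet Reg}
    {v : List Letter} {s : Reg} {μ : Mem} (h : μ.get w = []) :
    Exec (loop (.work w) f p) (cfg v s μ) (cfg v s μ) 1 :=
  Exec.loop_nil h

theorem exec_loop_cons {w : Work} {f : Reg → Option Bool → Reg} {p : Prog Alphabet Reg}
    {v : List Letter} {s : Reg} {μ : Mem} {a : Option Bool} {l : List (Option Bool)}
    {c₂ c₃ : Reg × (∀ k, List (Alphabet k))} {t₁ t₂ : ℕ} (h : μ.get w = a :: l)
    (h₁ : Exec p (cfg v (f s a) (μ.set w l)) c₂ t₁)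
    (h₂ : Exec (loop (.work w) f p) c₂ c₃ t₂) :
    Exec (loop (.work w) f p) (cfg v s μ) c₃ (1 + t₁ + t₂) := by
  refine Exec.loop_cons (T := allStacks v [] μ) h ?_ h₂
  have e : Function.update (allStacks v [] μ) (.work w) l = allStacks v [] (μ.set w l) :=
    update_allStacks_work _ _ _ _ _
  exact e ▸ h₁

/-- The register update of a loop that reads symbols. -/
def readSym (s : Reg) (a : Option Bool) : Reg :=
  { s with sym := a }

/-- Forget the symbols that were read. -/
def forget (s : Reg) : Reg :=
  { s with sym := none, sym' := none }

/-- Move the symbols of one work stack to another, which reverses their order. -/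
def move (w w' : Work) : Prog Alphabet Reg :=
  seq (loop (.work w) readSym (push (.work w') Reg.sym)) (load forget)

theorem exec_move {w w' : Work} (hw : w ≠ w') (v : List Letter) (s : Reg) (μ : Mem) :
    Exec (move w w') (cfg v s μ)
      (cfg v (forget s) ((μ.set w []).set w' ((μ.get w).reverse ++ μ.get w')))
      (2 * (μ.get w).length + 2) := by
  -- the loop leaves its last symbol in the registers, so these are described up to `forget`
  have key : ∀ (l : List (Option Bool)) (s : Reg) (μ : Mem), μ.get w = l → ∃ s', forget s' = forget s ∧
      Exec (loop (.work w) readSym (push (.work w') Reg.sym)) (cfg v s μ)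
        (cfg v s' ((μ.set w []).set w' (l.reverse ++ μ.get w'))) (2 * l.length + 1) := by
    intro l
    induction l with
    | nil =>
      intro s μ h
      refine ⟨s, rfl, (exec_loop_nil h).congr ?_ le_rfl⟩
      have h1 : μ.set w [] = μ := by rw [← h, Mem.set_get]
      rw [h1, List.reverse_nil, List.nil_append, Mem.set_get]
    | cons a l ih =>
      intro s μ h
      have hg : ((μ.set w l).set w' (a :: (μ.set w l).get w')).get w = l := by
        simp [Mem.get_set, hw]
      obtain ⟨s', hs', h1⟩ := ih (readSym s a) _ hg
      refine ⟨s', hs', (exec_loop_cons h (exec_push w' Reg.sym v _ _) h1).congr ?_ ?_⟩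
      · congr 1
        apply Mem.get_injective
        simp only [Mem.get_set, Function.update_self]
        rw [Function.update_of_ne hw.symm, Function.update_comm hw.symm]
        simp
      · simp only [List.length_cons]
        omega
  obtain ⟨s', hs', h⟩ := key _ s μ rfl
  refine (h.seq (Exec.load forget _ _)).congr ?_ (by omega)
  rw [hs']
  rfl

/-- Empty a work stack. -/
def clear (w : Work) : Prog Alphabet Reg :=
  loop (.work w) (fun s _ => s) (load id)

theorem exec_clear (w : Work) (v : List Letter) (s : Reg) (μ : Mem) :
    Exec (clear w) (cfg v s μ) (cfg v s (μ.set w [])) (2 * (μ.get w).length + 1) := by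
  generalize hl : μ.get w = l
  induction l generalizing μ with
  | nil =>
    refine (exec_loop_nil hl).congr ?_ le_rfl
    rw [← hl, Mem.set_get]
  | cons a l ih =>
    refine (exec_loop_cons hl (Exec.load id _ _)
      (ih (μ.set w l) (by simp [Mem.get_set]))).congr ?_ ?_
    · rw [Mem.set_set]
    · simp only [List.length_cons]
      omega

/-! ### The product of a Boolean matrix and the transpose of another -/

/-- The registers during the main computation. -/
def reg (ok acc : Bool) : Reg where
  letter := .endMatrix
  sym := none
  sym' := none
  acc := acc
  ok := ok
  start := true
  target := 0

/-- Compute the scalar products of the row in `r'` with the rows of the matrix in `x`. The row moves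
to `r` while a scalar product is computed, and back at the end of each row of the matrix. -/
def dotLoop : Prog Alphabet Reg :=
  loop (.work .x) readSym
    (ite (fun s => s.sym.isSome)
      (seq (pop (.work .r') fun s o => { s with sym' := Option.getD (α := Option Bool) o none })
        (seq (push (.work .r) Reg.sym')
          (seq (push (.work .x') Reg.sym)
            (load fun s => forget
              { s with acc := s.acc || (s.sym == some true && s.sym' == some true) }))))
      (seq (push (.work .x') Reg.sym)
        (seq (push (.work .y) fun s => some s.acc)
          (seq (load fun s => { s with acc := false }) (move .r .r')))))

/-- The part of the loop that reads the digits of one row; the rest of the loop is the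
hypothesis `hc`. -/
theorem exec_dotLoop_bits (v : List Letter) (ok : Bool) (rest : List (Option Bool)) {t : ℕ}
    {c : Reg × (∀ k, List (Alphabet k))} (u m : List Bool) (h : u.length = m.length) (acc : Bool)
    (μ : Mem) (hx : μ.x = u.map some ++ none :: rest) (hr : μ.r' = m.map some)
    (hc : Exec dotLoop (cfg v (reg ok (acc || boolDot m u))
      { μ with x := none :: rest, x' := (u.map some).reverse ++ μ.x',
               r := (m.map some).reverse ++ μ.r, r' := [] }) c t) :
    Exec dotLoop (cfg v (reg ok acc) μ) c (6 * u.length + t) := by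
  induction u generalizing m acc μ with
  | nil =>
    obtain rfl : m = [] := List.length_eq_zero_iff.1 h.symm
    cases μ
    simp_all [boolDot]
  | cons a u ih =>
    obtain ⟨b, m, rfl⟩ : ∃ b m', m = b :: m' := by
      cases m with
      | nil => simp at h
      | cons b m => exact ⟨b, m, rfl⟩
    simp only [List.length_cons, Nat.add_right_cancel_iff] at h
    obtain ⟨M₁, M₂, M₃, X, X', Y, R, R'⟩ := μ
    dsimp only at hx hr hc
    subst hx hr
    refine (exec_loop_cons (w := .x) rfl (Exec.ite_true rfl ((exec_pop .r' _ v _ _).seq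
      ((exec_push .r _ v _ _).seq ((exec_push .x' _ v _ _).seq (Exec.load _ _ _))))) ?_).mono
      (t₂ := 6 * (u.length + 1) + t) (t₁ := 1 + 5 + (6 * u.length + t)) (by omega)
    have e : (acc || ((some a == some true) && (some b == some true))) = (acc || (b && a)) := by
      cases a <;> cases b <;> rfl
    have h1 := ih m h (acc || (b && a)) ⟨M₁, M₂, M₃, u.map some ++ none :: rest, some a :: X', Y,
      some b :: R, m.map some⟩ rfl rfl (by simpa [boolDot, Bool.or_assoc] using hc)
    rw [← e] at h1
    exact h1

theorem exec_dotLoop (v : List Letter) (ok : Bool) (m : List Bool) (X : List (List Bool))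
    (hX : ∀ u ∈ X, u.length = m.length) (μ : Mem) (hx : μ.x = rowsCode X) (hr : μ.r = [])
    (hr' : μ.r' = m.map some) :
    Exec dotLoop (cfg v (reg ok false) μ) (cfg v (reg ok false)
      { μ with x := [], x' := (rowsCode X).reverse ++ μ.x',
               y := ((X.map fun u => boolDot m u).map some).reverse ++ μ.y })
      (8 * (rowsCode X).length + 1) := by
  induction X generalizing μ with
  | nil =>
    refine (exec_loop_nil (w := .x) hx).congr ?_ (by omega)
    cases μ
    simp_all [rowsCode]
  | cons u X ih =>
    rw [List.forall_mem_cons] at hX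
    obtain ⟨M₁, M₂, M₃, X₀, X', Y, R, R'⟩ := μ
    dsimp only at hx hr hr'
    subst hx hr hr'
    rw [rowsCode_cons]
    have h1 := ih hX.2 ⟨M₁, M₂, M₃, rowsCode X, none :: ((u.map some).reverse ++ X'),
      some (boolDot m u) :: Y, [], m.map some⟩ rfl rfl rfl
    have h2 := exec_move (w := .r) (w' := .r') (by decide) v (reg ok false)
      ⟨M₁, M₂, M₃, rowsCode X, none :: ((u.map some).reverse ++ X'),
        some (boolDot m u) :: Y, (m.map some).reverse, []⟩
    have h3 := exec_loop_cons (w := .x) (v := v) (s := reg ok (boolDot m u))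
      (μ := ⟨M₁, M₂, M₃, none :: rowsCode X, (u.map some).reverse ++ X', Y,
        (m.map some).reverse, []⟩) rfl (Exec.ite_false rfl ((exec_push .x' _ v _ _).seq
        ((exec_push .y _ v _ _).seq ((Exec.load _ _ _).seq (h2.congr (c₃ := cfg v (reg ok false)
          ⟨M₁, M₂, M₃, rowsCode X, none :: ((u.map some).reverse ++ X'),
            some (boolDot m u) :: Y, [], m.map some⟩)
          (by simp [Mem.set, Mem.get, forget, reg]) le_rfl))))) h1
    change Exec dotLoop _ _ _ at h3
    refine (exec_dotLoop_bits v ok (rowsCode X) u m hX.1 false _ rfl rfl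
      (by simpa using h3)).congr ?_ ?_
    · simp
    · simp [Mem.get, hX.1]
      omega

/-- Write the product `M Xᵀ` to `y`, in reverse order, where `M` is the matrix in `mat i` and `X` is
the matrix in `x`. The matrix `M` is put aside. -/
def mulLoop (i : Fin 2) : Prog Alphabet Reg :=
  loop (.work (.mat i)) readSym
    (ite (fun s => s.sym.isSome)
      (seq (push (.work (.rev i)) Reg.sym)
        (seq (push (.work .r) Reg.sym) (load forget)))
      (seq (push (.work (.rev i)) Reg.sym)
        (seq (move .r .r')
          (seq dotLoop
            (seq (push (.work .y) fun _ => none)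
              (seq (move .x' .x) (clear .r')))))))

/-- The part of the loop that copies the digits of one row of `M` to `r`; the rest of the loop is the
hypothesis `hc`. -/
theorem exec_mulLoop_bits (i : Fin 2) (v : List Letter) (ok : Bool) (rest : List (Option Bool))
    {t : ℕ} {c : Reg × (∀ k, List (Alphabet k))} (m : List Bool) (μ : Mem)
    (hm : μ.mat i = m.map some ++ none :: rest)
    (hc : Exec (mulLoop i) (cfg v (reg ok false)
      { μ with mat := Function.update μ.mat i (none :: rest),
               rev := Function.update μ.rev i ((m.map some).reverse ++ μ.rev i),
               r := (m.map some).reverse ++ μ.r }) c t) :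
    Exec (mulLoop i) (cfg v (reg ok false) μ) c (5 * m.length + t) := by
  induction m generalizing μ with
  | nil =>
    have e : Function.update μ.mat i (none :: rest) = μ.mat := by
      rw [← List.nil_append (none :: rest), ← List.map_nil, ← hm, Function.update_eq_self]
    rw [e] at hc
    simpa using hc
  | cons a m ih =>
    refine (exec_loop_cons (w := .mat i) hm (Exec.ite_true rfl ((exec_push (.rev i) _ v _ _).seq
      ((exec_push .r _ v _ _).seq (Exec.load _ _ _)))) ?_).mono
      (t₂ := 5 * (m.length + 1) + t) (t₁ := 1 + 4 + (5 * m.length + t)) (by omega)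
    refine ih _ ?_ ?_
    · simp [Mem.set]
    · simpa [Mem.set, Mem.get, readSym, forget, reg] using hc

theorem exec_mulLoop (i : Fin 2) (v : List Letter) (ok : Bool) {n : ℕ} (M X : List (List Bool))
    (hM : ∀ m ∈ M, m.length = n) (hX : ∀ u ∈ X, u.length = n) (μ : Mem)
    (hm : μ.mat i = rowsCode M) (hx : μ.x = rowsCode X) (hx' : μ.x' = []) (hr : μ.r = [])
    (hr' : μ.r' = []) :
    Exec (mulLoop i) (cfg v (reg ok false) μ) (cfg v (reg ok false)
      { μ with mat := Function.update μ.mat i [],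
               rev := Function.update μ.rev i ((rowsCode M).reverse ++ μ.rev i),
               y := (rowsCode (mulTranspose M X)).reverse ++ μ.y })
      ((rowsCode M).length * (10 * (rowsCode X).length + 10) + 1) := by
  induction M generalizing μ with
  | nil =>
    refine (exec_loop_nil (w := .mat i) hm).congr ?_ (by omega)
    have e : Function.update μ.mat i [] = μ.mat := by
      rw [show ([] : List (Option Bool)) = rowsCode [] from rfl, ← hm, Function.update_eq_self]
    rw [e]
    simp [rowsCode, mulTranspose]
  | cons m M ih =>
    rw [List.forall_mem_cons] at hM
    obtain ⟨M₁, M₂, M₃, X₀, X', Y, R, R'⟩ := μ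
    dsimp only at hm hx hx' hr hr'
    subst hx hx' hr hr'
    rw [rowsCode_cons] at hm
    set M₁' := Function.update M₁ i (rowsCode M) with hM₁
    set M₂' := Function.update M₂ i (none :: ((m.map some).reverse ++ M₂ i)) with hM₂
    have h1 := exec_move (w := .r) (w' := .r') (by decide) v (readSym (reg ok false) none)
      ⟨M₁', M₂', M₃, rowsCode X, [], Y, (m.map some).reverse, []⟩
    have h2 := exec_dotLoop v ok m X (fun u hu => (hX u hu).trans hM.1.symm)
      ⟨M₁', M₂', M₃, rowsCode X, [], Y, [], m.map some⟩ rfl rfl rfl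
    have h3 := exec_push .y (fun _ => none) v (reg ok false)
      ⟨M₁', M₂', M₃, [], (rowsCode X).reverse,
        ((X.map fun u => boolDot m u).map some).reverse ++ Y, [], m.map some⟩
    have h4 := exec_move (w := .x') (w' := .x) (by decide) v (reg ok false)
      ⟨M₁', M₂', M₃, [], (rowsCode X).reverse,
        none :: (((X.map fun u => boolDot m u).map some).reverse ++ Y), [], m.map some⟩
    have h5 := exec_clear .r' v (reg ok false)
      ⟨M₁', M₂', M₃, rowsCode X, [],
        none :: (((X.map fun u => boolDot m u).map some).reverse ++ Y), [], m.map some⟩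
    have h6 := ih hM.2 ⟨M₁', M₂', M₃, rowsCode X, [],
      none :: (((X.map fun u => boolDot m u).map some).reverse ++ Y), [], []⟩
      (by simp [hM₁]) rfl rfl rfl rfl
    have h7 := exec_loop_cons (w := .mat i) (v := v) (s := reg ok false)
      (μ := ⟨Function.update M₁ i (none :: rowsCode M),
        Function.update M₂ i ((m.map some).reverse ++ M₂ i), M₃, rowsCode X, [], Y,
        (m.map some).reverse ++ [], []⟩) (a := none) (l := rowsCode M) (by simp [Mem.get])
      (Exec.ite_false rfl (((exec_push (.rev i) Reg.sym v _ _).congr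
          (c₃ := cfg v (readSym (reg ok false) none)
            ⟨M₁', M₂', M₃, rowsCode X, [], Y, (m.map some).reverse, []⟩)
          (by simp [Mem.set, Mem.get, hM₁, hM₂, readSym]) le_rfl).seq
        ((h1.congr (c₃ := cfg v (reg ok false)
          ⟨M₁', M₂', M₃, rowsCode X, [], Y, [], m.map some⟩)
          (by simp [Mem.set, Mem.get, forget, readSym, reg]) le_rfl).seq
        ((h2.congr (c₃ := cfg v (reg ok false) ⟨M₁', M₂', M₃, [], (rowsCode X).reverse,
          ((X.map fun u => boolDot m u).map some).reverse ++ Y, [], m.map some⟩)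
          (by simp) le_rfl).seq (h3.seq
        ((h4.congr (c₃ := cfg v (reg ok false) ⟨M₁', M₂', M₃, rowsCode X, [],
          none :: (((X.map fun u => boolDot m u).map some).reverse ++ Y), [], m.map some⟩)
          (by simp [Mem.set, Mem.get, forget, reg]) le_rfl).seq h5)))))) h6
    change Exec (mulLoop i) _ _ _ at h7
    refine (exec_mulLoop_bits i v ok (rowsCode M) m _ hm h7).congr ?_ ?_
    · simp [rowsCode_cons, mulTranspose, hM₁, hM₂]
    · simp only [Mem.get, List.length_reverse, List.length_map, rowsCode_cons, List.length_append,
        List.length_cons, hM.1]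
      nlinarith [Nat.zero_le (n * (rowsCode X).length)]

/-- Replace the matrix `X` in `x` by `M Xᵀ`, where `M` is the matrix in `mat i`. -/
def mul (i : Fin 2) : Prog Alphabet Reg :=
  seq (mulLoop i) (seq (clear .x) (seq (move .y .x) (move (.rev i) (.mat i))))

/-- The memory between the steps of the main computation: two matrices, the current matrix, and
the counters. -/
def mem (A : Fin 2 → List (List Bool)) (X : List (List Bool)) (C : Fin 2 → ℕ) : Mem where
  mat i := rowsCode (A i)
  rev _ := []
  cnt i := List.replicate (C i) none
  x := rowsCode X
  x' := []
  y := []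
  r := []
  r' := []

theorem exec_mul (i : Fin 2) (ok : Bool) {n : ℕ} {A : Fin 2 → List (List Bool)}
    {X : List (List Bool)} (C : Fin 2 → ℕ) (hA : IsSquare n (A i)) (hX : IsSquare n X) :
    Exec (mul i) (cfg [] (reg ok false) (mem A X C))
      (cfg [] (reg ok false) (mem A (mulTranspose (A i) X) C))
      (10 * (n * (n + 1)) ^ 2 + 16 * (n * (n + 1)) + 6) := by
  set Y := mulTranspose (A i) X with hY
  have hYs : IsSquare n Y := hA.mulTranspose hX
  have h1 := exec_mulLoop i [] ok (A i) X hA.2 hX.2 (mem A X C) rfl rfl rfl rfl rfl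
  set M₁ := Function.update (mem A X C).mat i [] with hM₁
  set M₂ := Function.update (mem A X C).rev i (rowsCode (A i)).reverse with hM₂
  have h2 := exec_clear .x [] (reg ok false)
    ⟨M₁, M₂, (mem A X C).cnt, rowsCode X, [], (rowsCode Y).reverse, [], []⟩
  have h3 := exec_move (w := .y) (w' := .x) (by decide) [] (reg ok false)
    ⟨M₁, M₂, (mem A X C).cnt, [], [], (rowsCode Y).reverse, [], []⟩
  have h4 := exec_move (w := .rev i) (w' := .mat i) (by simp) [] (reg ok false)
    ⟨M₁, M₂, (mem A X C).cnt, rowsCode Y, [], [], [], []⟩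
  have h5 := (h1.congr (c₃ := cfg [] (reg ok false)
      ⟨M₁, M₂, (mem A X C).cnt, rowsCode X, [], (rowsCode Y).reverse, [], []⟩)
      (by simp [mem, hM₂, hM₁, hY]) le_rfl).seq
    (h2.seq ((h3.congr (c₃ := cfg [] (reg ok false)
      ⟨M₁, M₂, (mem A X C).cnt, rowsCode Y, [], [], [], []⟩)
      (by simp [Mem.set, Mem.get, forget, reg]) le_rfl).seq h4))
  refine h5.congr ?_ ?_
  · have e1 : Function.update M₁ i (rowsCode (A i)) = fun i => rowsCode (A i) := by
      rw [hM₁, Function.update_idem]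
      exact Function.update_eq_self i (fun i => rowsCode (A i))
    have e2 : Function.update M₂ i [] = fun _ => [] := by
      rw [hM₂, Function.update_idem]
      exact Function.update_eq_self i (fun _ => [])
    have e3 : M₁ i = [] := by simp [hM₁]
    have e4 : M₂ i = (rowsCode (A i)).reverse := by simp [hM₂]
    simp [Mem.set, Mem.get, forget, reg, e1, e2, e3, e4, mem]
  · have e4 : M₂ i = (rowsCode (A i)).reverse := by simp [hM₂]
    simp only [Mem.get, e4, List.length_reverse, hA.length_rowsCode, hX.length_rowsCode,
      hYs.length_rowsCode]
    ring_nf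
    omega

/-! ### The test of a pair of letters -/

/-- The result of `N` rounds of multiplications `X ↦ M Xᵀ` by the matrices `a`, `b`, `b`, `a`. -/
def rounds (A : Fin 2 → List (List Bool)) (a b : Fin 2) (X : List (List Bool)) :
    ℕ → List (List Bool)
  | 0 => X
  | N + 1 => rounds A a b (mulTranspose (A a) (mulTranspose (A b) (mulTranspose (A b)
      (mulTranspose (A a) X)))) N

/-- Whether all entries are true. -/
def allTrue (X : List (List Bool)) : Bool :=
  X.all fun r => r.all id

/-- Copy the matrix `a` to `x`. -/
def copy (a : Fin 2) : Prog Alphabet Reg :=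
  seq (move (.mat a) (.rev a))
    (loop (.work (.rev a)) readSym
      (seq (push (.work (.mat a)) Reg.sym) (seq (push (.work .x) Reg.sym) (load forget))))

theorem exec_copy (a : Fin 2) (ok : Bool) {n : ℕ} {A : Fin 2 → List (List Bool)}
    (C : Fin 2 → ℕ) (hA : IsSquare n (A a)) :
    Exec (copy a) (cfg [] (reg ok false) (mem A [] C)) (cfg [] (reg ok false) (mem A (A a) C))
      (6 * (n * (n + 1)) + 3) := by
  have key : ∀ (l : List (Option Bool)) (μ : Mem), μ.rev a = l →
      Exec (loop (.work (.rev a)) readSym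
        (seq (push (.work (.mat a)) Reg.sym) (seq (push (.work .x) Reg.sym) (load forget))))
        (cfg [] (reg ok false) μ) (cfg [] (reg ok false)
          { μ with mat := Function.update μ.mat a (l.reverse ++ μ.mat a),
                   rev := Function.update μ.rev a [], x := l.reverse ++ μ.x })
        (4 * l.length + 1) := by
    intro l
    induction l with
    | nil =>
      intro μ h
      refine (exec_loop_nil (w := .rev a) h).congr ?_ le_rfl
      rw [← h, Function.update_eq_self, h]
      simp
    | cons b l ih =>
      intro μ h
      refine (exec_loop_cons (w := .rev a) h ((exec_push (.mat a) Reg.sym _ _ _).seq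
        ((exec_push .x Reg.sym _ _ _).seq (Exec.load _ _ _)))
        (ih ⟨Function.update μ.mat a (b :: μ.mat a), Function.update μ.rev a l, μ.cnt,
          b :: μ.x, μ.x', μ.y, μ.r, μ.r'⟩ (by simp))).congr ?_ ?_
      · simp
      · simp only [List.length_cons]
        omega
  have h1 := exec_move (w := .mat a) (w' := .rev a) (by simp) [] (reg ok false) (mem A [] C)
  have h2 := key (rowsCode (A a)).reverse
    ⟨Function.update (mem A [] C).mat a [],
      Function.update (mem A [] C).rev a (rowsCode (A a)).reverse, (mem A [] C).cnt, [], [], [], [],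
      []⟩ (by simp)
  refine ((h1.congr (by simp [Mem.set, Mem.get, mem, forget, reg, rowsCode]) le_rfl).seq
    h2).congr ?_ ?_
  · simp [mem]
  · simp only [Mem.get, mem, List.length_reverse, hA.length_rowsCode]
    omega

theorem mem_set_cnt (A : Fin 2 → List (List Bool)) (X : List (List Bool)) (C : Fin 2 → ℕ)
    (i : Fin 2) (k : ℕ) :
    (mem A X C).set (.cnt i) (List.replicate k none) = mem A X (Function.update C i k) := by
  have e : Function.update (fun j => List.replicate (C j) (none : Option Bool)) i
      (List.replicate k none) = fun j => List.replicate (Function.update C i k j) none := by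
    funext j
    by_cases h : j = i
    · subst h
      simp
    · simp [h]
  simp [mem, Mem.set, e]

/-- Carry out the multiplications by the matrices `a`, `b`, `b`, `a` as often as the counter `u`
says, and move this counter to the counter `w`. -/
def roundsLoop (a b u w : Fin 2) : Prog Alphabet Reg :=
  loop (.work (.cnt u)) (fun s _ => s)
    (seq (mul a) (seq (mul b) (seq (mul b) (seq (mul a) (push (.work (.cnt w)) fun _ => none)))))

theorem exec_roundsLoop (a b u w : Fin 2) (huw : u ≠ w) (ok : Bool) {n N : ℕ}
    {A : Fin 2 → List (List Bool)} (hA : ∀ i, IsSquare n (A i)) {X : List (List Bool)}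
    (hX : IsSquare n X) (C : Fin 2 → ℕ) (hC : C u = N) :
    Exec (roundsLoop a b u w) (cfg [] (reg ok false) (mem A X C))
      (cfg [] (reg ok false) (mem A (rounds A a b X N)
        (Function.update (Function.update C u 0) w (C w + N))))
      (N * (4 * (10 * (n * (n + 1)) ^ 2 + 16 * (n * (n + 1)) + 6) + 2) + 1) := by
  induction N generalizing X C with
  | zero =>
    refine (exec_loop_nil (w := .cnt u) ?_).congr ?_ (by omega)
    · simp [mem, Mem.get, hC]
    · rw [← hC, Function.update_eq_self, hC, add_zero, Function.update_eq_self]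
      rfl
  | succ N ih =>
    have sq : ∀ i {Y}, IsSquare n Y → IsSquare n (mulTranspose (A i) Y) := fun i _ hY =>
      (hA i).mulTranspose hY
    have hu : (mem A X C).get (.cnt u) = none :: List.replicate N none := by
      simp [mem, Mem.get, hC, List.replicate_succ]
    set C₁ := Function.update C u N with hC₁
    set C₂ := Function.update C₁ w (C w + 1) with hC₂
    have e₁ := mem_set_cnt A X C u N
    have h1 := exec_mul a ok C₁ (hA a) hX
    have h2 := exec_mul b ok C₁ (hA b) (sq a hX)
    have h3 := exec_mul b ok C₁ (hA b) (sq b (sq a hX))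
    have h4 := exec_mul a ok C₁ (hA a) (sq b (sq b (sq a hX)))
    set Y := mulTranspose (A a) (mulTranspose (A b) (mulTranspose (A b) (mulTranspose (A a) X)))
      with hY
    have h5 := exec_push (.cnt w) (fun _ => none) [] (reg ok false) (mem A Y C₁)
    have e₂ : (mem A Y C₁).set (.cnt w) (none :: (mem A Y C₁).get (.cnt w)) = mem A Y C₂ := by
      rw [hC₂, ← mem_set_cnt A Y C₁ w (C w + 1), List.replicate_succ]
      simp [mem, Mem.get, hC₁, huw.symm]
    rw [e₂] at h5
    have h6 := ih (sq a (sq b (sq b (sq a hX)))) C₂ (by simp [hC₂, hC₁, huw])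
    refine (exec_loop_cons hu (e₁ ▸ h1.seq (h2.seq (h3.seq (h4.seq h5)))) h6).congr ?_ ?_
    · have e₃ : Function.update (Function.update C₂ u 0) w (C₂ w + N) =
          Function.update (Function.update C u 0) w (C w + (N + 1)) := by
        rw [hC₂, hC₁, Function.update_comm huw.symm, Function.update_idem, Function.update_idem]
        simp only [Function.update_self]
        congr 1
        omega
      rw [e₃]
      rfl
    · ring_nf
      omega

/-- Empty the stack `x`, and record whether all entries of its matrix are true. -/
def check : Prog Alphabet Reg :=
  loop (.work .x) (fun s a => { s with ok := s.ok && a != some false }) (load id)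

theorem all_rowsCode (X : List (List Bool)) :
    (rowsCode X).all (· != some false) = allTrue X := by
  induction X with
  | nil => rfl
  | cons r X ih =>
    have h : (fun a : Bool => some a != some false) = id := by
      funext a
      cases a <;> rfl
    rw [rowsCode_cons, List.all_append, List.all_cons, ih, List.all_map]
    have h' : ((none : Option Bool) != some false) = true := rfl
    simp [allTrue, Function.comp_def, h, h']

theorem exec_check (ok : Bool) (A : Fin 2 → List (List Bool)) (X : List (List Bool))
    (C : Fin 2 → ℕ) :
    Exec check (cfg [] (reg ok false) (mem A X C))
      (cfg [] (reg (ok && allTrue X) false) (mem A [] C)) (2 * (rowsCode X).length + 1) := by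
  have key : ∀ (l : List (Option Bool)) (ok : Bool) (μ : Mem), μ.x = l →
      Exec check (cfg [] (reg ok false) μ)
        (cfg [] (reg (ok && l.all (· != some false)) false) { μ with x := [] })
        (2 * l.length + 1) := by
    intro l
    induction l with
    | nil =>
      intro ok μ h
      refine (exec_loop_nil (w := .x) h).congr ?_ le_rfl
      rw [List.all_nil, Bool.and_true, ← h]
    | cons a l ih =>
      intro ok μ h
      have h1 : Exec (load id) (cfg [] (reg (ok && a != some false) false) { μ with x := l })
          (cfg [] (reg (ok && a != some false) false) { μ with x := l }) 1 := Exec.load _ _ _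
      refine (exec_loop_cons (w := .x) (s := reg ok false)
        (f := fun s a => { s with ok := s.ok && a != some false }) h h1
        (ih (ok && a != some false) { μ with x := l } rfl)).congr ?_ ?_
      · rw [List.all_cons, Bool.and_assoc]
      · simp only [List.length_cons]
        omega
  have h := key (rowsCode X) ok (mem A X C) rfl
  rw [all_rowsCode] at h
  exact h

/-- The test for the letters `a` and `b`, which records its result in the register `ok`. -/
def test (a b u w : Fin 2) : Prog Alphabet Reg :=
  seq (copy a) (seq (roundsLoop a b u w) check)

theorem IsSquare.rounds {n : ℕ} {A : Fin 2 → List (List Bool)} (hA : ∀ i, IsSquare n (A i))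
    (a b : Fin 2) {X : List (List Bool)} (hX : IsSquare n X) (N : ℕ) :
    IsSquare n (rounds A a b X N) := by
  induction N generalizing X with
  | zero => exact hX
  | succ N ih =>
    exact ih ((hA a).mulTranspose ((hA b).mulTranspose ((hA b).mulTranspose
      ((hA a).mulTranspose hX))))

theorem exec_test (a b u w : Fin 2) (huw : u ≠ w) (ok : Bool) {n N : ℕ}
    {A : Fin 2 → List (List Bool)} (hA : ∀ i, IsSquare n (A i)) (C : Fin 2 → ℕ) (hC : C u = N)
    (hC' : C w = 0) :
    Exec (test a b u w) (cfg [] (reg ok false) (mem A [] C))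
      (cfg [] (reg (ok && allTrue (rounds A a b (A a) N)) false)
        (mem A [] (Function.update (Function.update C u 0) w N)))
      (8 * (n * (n + 1)) + 5 +
        N * (4 * (10 * (n * (n + 1)) ^ 2 + 16 * (n * (n + 1)) + 6) + 2)) := by
  refine ((exec_copy a ok C (hA a)).seq ((exec_roundsLoop a b u w huw ok hA (hA a) C hC).seq
    (exec_check _ _ _ _))).congr ?_ ?_
  · rw [hC', zero_add]
  · rw [(IsSquare.rounds hA a b (hA a) N).length_rowsCode]
    omega

/-! ### Reading the input -/

/-- The symbol to store after a letter was read: an entry is positive if its first letter is a digit,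
since the numerator zero has no digits. -/
def emit (s : Reg) : Option (Option Bool) :=
  match s.letter, s.start with
  | .bit _, true => some (some true)
  | .slash, true => some (some false)
  | .endRow, _ => some none
  | _, _ => none

/-- The register update of the loop that reads the input. -/
def setLetter (s : Reg) (a : Letter) : Reg :=
  { s with letter := a }

/-- The registers while reading. -/
def readReg (target : Fin 2) (start : Bool) : Reg :=
  { reg true false with start := start, target := target }

/-- The update of the registers after a letter was processed. -/
def advance (s : Reg) : Reg :=
  match s.letter with
  | .bit _ => readReg s.target false
  | .minus => readReg s.target false
  | .slash => readReg s.target false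
  | .endEntry => readReg s.target true
  | .endRow => readReg s.target s.start
  | .endMatrix => readReg 1 s.start

/-- Read the input: store the matrices of the positivity of the entries, in reverse order, and count
the entries. -/
def parse : Prog Alphabet Reg :=
  loop .input setLetter
    (seq (ite (fun s => (emit s).isSome)
        (ite (fun s => s.target = 0)
          (push (.work (.rev 0)) fun s => Option.getD (α := Option Bool) (emit s) none)
          (push (.work (.rev 1)) fun s => Option.getD (α := Option Bool) (emit s) none))
        (load id))
      (seq (ite (fun s => s.letter = .endEntry) (push (.work (.cnt 0)) fun _ => none) (load id))
        (load advance)))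

/-- The effect of a letter of the input. -/
def readLetter (c : Reg × Mem) (a : Letter) : Reg × Mem :=
  let s := setLetter c.1 a
  let μ := match emit s with
    | some e => c.2.set (.rev s.target) (e :: c.2.get (.rev s.target))
    | none => c.2
  (advance s, if a = .endEntry then μ.set (.cnt 0) (none :: μ.get (.cnt 0)) else μ)

theorem exec_parse (v : List Letter) (c : Reg × Mem) :
    Exec parse (cfg v c.1 c.2) (cfg [] (v.foldl readLetter c).1 (v.foldl readLetter c).2)
      (7 * v.length + 1) := by
  induction v generalizing c with
  | nil => exact Exec.loop_nil rfl
  | cons a v ih =>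
    obtain ⟨s, μ⟩ := c
    set s' : Reg := setLetter s a with hs'
    let ν : Mem := match emit s' with
      | some e => μ.set (.rev s'.target) (e :: μ.get (.rev s'.target))
      | none => μ
    have h1 : Exec (ite (fun s => (emit s).isSome)
        (ite (fun s => s.target = 0)
          (push (.work (.rev 0)) fun s => Option.getD (α := Option Bool) (emit s) none)
          (push (.work (.rev 1)) fun s => Option.getD (α := Option Bool) (emit s) none))
        (load id)) (cfg v s' μ) (cfg v s' ν) 3 := by
      cases he : emit s' with
      | none =>
        refine ((Exec.load id _ _).ite_false (by simp [he])).congr ?_ (by omega)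
        simp only [ν, he]
        rfl
      | some e =>
        refine Exec.ite_true (by simp [cfg, he]) (t := 2) ?_
        by_cases ht : s'.target = 0
        · refine Exec.ite_true (by simp [cfg, ht]) ((exec_push (.rev 0) _ v s' μ).congr ?_ le_rfl)
          simp only [ν, he, ht, Option.getD_some]
        · have ht' : s'.target = 1 := by omega
          refine Exec.ite_false (by simp [cfg, ht]) ((exec_push (.rev 1) _ v s' μ).congr ?_ le_rfl)
          simp only [ν, he, ht', Option.getD_some]
    have h2 : Exec (ite (fun s => s.letter = .endEntry)
        (push (.work (.cnt 0)) fun _ => none) (load id)) (cfg v s' ν) (cfg v s'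
          (if a = .endEntry then ν.set (.cnt 0) (none :: ν.get (.cnt 0)) else ν)) 2 := by
      by_cases ha : a = .endEntry
      · rw [if_pos ha]
        exact Exec.ite_true (by simp [cfg, hs', setLetter, ha]) (exec_push (.cnt 0) _ v s' ν)
      · rw [if_neg ha]
        exact Exec.ite_false (by simp [cfg, hs', setLetter, ha]) (Exec.load id _ _)
    have e : Function.update (allStacks (a :: v) [] μ) .input v = allStacks v [] μ :=
      update_allStacks_input _ _ _ _
    have h12 := h1.seq (h2.seq (Exec.load advance _ _))
    have h3 := Exec.loop_cons (Γ := Alphabet) (k := .input) (f := setLetter)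
      (T := allStacks (a :: v) [] μ) (s := s) rfl (by rw [e]; exact h12) (ih (readLetter (s, μ) a))
    exact h3.congr rfl (by simp only [List.length_cons]; omega)

/-- The memory while reading. -/
def readMem (m : Fin 2 → List (Option Bool)) (k : ℕ) : Mem where
  mat _ := []
  rev := m
  cnt := Function.update (fun _ => []) 0 (List.replicate k none)
  x := []
  x' := []
  y := []
  r := []
  r' := []

theorem readLetter_first (t : Fin 2) (m : Fin 2 → List (Option Bool)) (k : ℕ) (a : Letter)
    (e : Bool) (ha : (∃ b, a = .bit b) ∧ e = true ∨ a = .slash ∧ e = false) :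
    readLetter (readReg t true, readMem m k) a =
      (readReg t false, readMem (Function.update m t (some e :: m t)) k) := by
  obtain ⟨⟨b, rfl⟩, rfl⟩ | ⟨rfl, rfl⟩ := ha <;> rfl

theorem foldl_readLetter_rest (t : Fin 2) (μ : Mem) (l : List Letter)
    (h : ∀ a ∈ l, a = .slash ∨ ∃ b, a = .bit b) :
    l.foldl readLetter (readReg t false, μ) = (readReg t false, μ) := by
  induction l with
  | nil => rfl
  | cons a l ih =>
    rw [List.forall_mem_cons] at h
    rw [List.foldl_cons]
    obtain ⟨rfl | ⟨b, rfl⟩, h⟩ := h <;> exact ih h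

theorem readLetter_endEntry (t : Fin 2) (s : Bool) (m : Fin 2 → List (Option Bool)) (k : ℕ) :
    readLetter (readReg t s, readMem m k) .endEntry = (readReg t true, readMem m (k + 1)) := by
  have e : readLetter (readReg t s, readMem m k) .endEntry =
    (readReg t true, (readMem m k).set (.cnt 0) (none :: (readMem m k).get (.cnt 0))) := rfl
  rw [e]
  simp [readMem, Mem.set, Mem.get, List.replicate_succ]

theorem foldl_readLetter_rat (t : Fin 2) (m : Fin 2 → List (Option Bool)) (k : ℕ) {q : ℚ}
    (hq : 0 ≤ q) :
    (encodeRat q ++ [Letter.endEntry]).foldl readLetter (readReg t true, readMem m k) =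
      (readReg t true, readMem (Function.update m t (some (decide (0 < q)) :: m t)) (k + 1)) := by
  have hbits : ∀ j, ∀ a ∈ encodeNat j, a = .slash ∨ ∃ b, a = Letter.bit b := by
    intro j a ha
    obtain ⟨b, _, rfl⟩ := List.mem_map.1 ha
    exact Or.inr ⟨b, rfl⟩
  rw [List.foldl_append, encodeRat, if_neg (not_lt.2 hq), List.nil_append]
  suffices h : (encodeNat q.num.natAbs ++ Letter.slash :: encodeNat q.den).foldl readLetter
      (readReg t true, readMem m k) =
      (readReg t false, readMem (Function.update m t (some (decide (0 < q)) :: m t)) k) by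
    rw [h]
    exact readLetter_endEntry _ _ _ _
  cases hc : encodeNat q.num.natAbs with
  | nil =>
    have h0 : q = 0 := by
      have h1 : q.num.natAbs = 0 := encodeNat_injective (by rw [hc]; rfl)
      rwa [Int.natAbs_eq_zero, Rat.num_eq_zero] at h1
    rw [List.nil_append, List.foldl_cons, readLetter_first t m k .slash false (Or.inr ⟨rfl, rfl⟩),
      foldl_readLetter_rest _ _ _ (hbits _), h0]
    simp
  | cons a l =>
    have h0 : 0 < q := by
      refine hq.lt_of_ne ?_
      rintro rfl
      simp [encodeNat] at hc
    have hal : ∀ c ∈ a :: l, c = .slash ∨ ∃ b, c = Letter.bit b := hc ▸ hbits _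
    have ha : ∃ b, a = .bit b := by
      have : a ∈ encodeNat q.num.natAbs := by rw [hc]; exact List.mem_cons_self
      obtain ⟨b, _, rfl⟩ := List.mem_map.1 this
      exact ⟨b, rfl⟩
    rw [List.cons_append, List.foldl_cons, readLetter_first t m k a true (Or.inl ⟨ha, rfl⟩),
      foldl_readLetter_rest, decide_eq_true h0]
    intro c hc'
    rcases List.mem_append.1 hc' with h | h
    · exact hal c (List.mem_cons_of_mem _ h)
    · rcases List.mem_cons.1 h with rfl | h
      · exact Or.inl rfl
      · exact hbits _ _ h

theorem foldl_readLetter_entries (t : Fin 2) (m : Fin 2 → List (Option Bool)) (k : ℕ) (r : List ℚ)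
    (hr : ∀ q ∈ r, 0 ≤ q) :
    (encodeRow r).foldl readLetter (readReg t true, readMem m k) =
      (readReg t true, readMem (Function.update m t
        (((r.map fun q => decide (0 < q)).map some).reverse ++ m t)) (k + r.length)) := by
  induction r generalizing m k with
  | nil => simp [encodeRow, encodeBlocks]
  | cons q r ih =>
    rw [List.forall_mem_cons] at hr
    have e : encodeRow (q :: r) = (encodeRat q ++ [Letter.endEntry]) ++ encodeRow r := by
      simp [encodeRow, encodeBlocks]
    rw [e, List.foldl_append, foldl_readLetter_rat t m k hr.1, ih _ _ hr.2]
    have e' : k + 1 + r.length = k + (r.length + 1) := by omega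
    simp [e']

/-- The positivity of the entries of a list of rows. -/
def positivity (M : List (List ℚ)) : List (List Bool) :=
  M.map fun r => r.map fun q => decide (0 < q)

theorem foldl_readLetter_rows {n : ℕ} (t : Fin 2) (m : Fin 2 → List (Option Bool)) (k : ℕ)
    (M : List (List ℚ)) (hM : ∀ r ∈ M, ∀ q ∈ r, 0 ≤ q) (hn : ∀ r ∈ M, r.length = n) :
    (encodeMatrix M).foldl readLetter (readReg t true, readMem m k) =
      (readReg t true, readMem (Function.update m t
        ((rowsCode (positivity M)).reverse ++ m t)) (k + M.length * n)) := by
  induction M generalizing m k with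
  | nil => simp [encodeMatrix, encodeBlocks, positivity, rowsCode]
  | cons r M ih =>
    rw [List.forall_mem_cons] at hM hn
    have e : encodeMatrix (r :: M) = encodeRow r ++ .endRow :: encodeMatrix M := by
      simp [encodeMatrix, encodeBlocks]
    have e' : ∀ m k, readLetter (readReg t true, readMem m k) .endRow =
        (readReg t true, readMem (Function.update m t (none :: m t)) k) := fun _ _ => rfl
    rw [e, List.foldl_append, foldl_readLetter_entries t m k r hM.1, List.foldl_cons, e',
      ih _ _ hM.2 hn.2]
    have e'' : k + n + M.length * n = k + (M.length + 1) * n := by ring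
    simp [positivity, rowsCode_cons, hn.1, e'']

theorem foldl_readLetter_matrices {n : ℕ} (M M' : List (List ℚ))
    (hM : ∀ r ∈ M, ∀ q ∈ r, 0 ≤ q) (hM' : ∀ r ∈ M', ∀ q ∈ r, 0 ≤ q)
    (hn : ∀ r ∈ M, r.length = n) (hn' : ∀ r ∈ M', r.length = n) :
    (encodeBlocks .endMatrix encodeMatrix [M, M']).foldl readLetter
        (readReg 0 true, readMem (fun _ => []) 0) =
      (readReg 1 true, readMem ![(rowsCode (positivity M)).reverse,
        (rowsCode (positivity M')).reverse] (M.length * n + M'.length * n)) := by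
  have e : encodeBlocks .endMatrix encodeMatrix [M, M'] =
      encodeMatrix M ++ .endMatrix :: (encodeMatrix M' ++ [.endMatrix]) := by
    simp [encodeBlocks]
  have e' : ∀ t μ, readLetter (readReg t true, μ) .endMatrix = (readReg 1 true, μ) :=
    fun _ _ => rfl
  rw [e, List.foldl_append, foldl_readLetter_rows 0 _ _ M hM hn, List.foldl_cons, e',
    List.foldl_append, foldl_readLetter_rows 1 _ _ M' hM' hn', List.foldl_cons, e',
    List.foldl_nil]
  congr 2
  · funext i
    fin_cases i <;> simp
  · omega

/-! ### The decision program -/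

/-- The program: read the two matrices, then test the pairs of letters `0 0`, `1 1` and `0 1`, where
each test moves the counter, then clean up and output the result. -/
def program : Prog Alphabet Reg :=
  seq parse (seq (load fun _ => reg true false)
    (seq (move (.rev 0) (.mat 0)) (seq (move (.rev 1) (.mat 1))
      (seq (test 0 0 0 1) (seq (test 1 1 1 0) (seq (test 0 1 0 1)
        (seq (clear (.mat 0)) (seq (clear (.mat 1)) (seq (clear (.cnt 1))
          (seq (push .output Reg.ok) (load fun _ => reg true false)))))))))))

/-- The result of the program, for Boolean matrices `A` and `N` rounds of multiplications. -/
def answer (A : Fin 2 → List (List Bool)) (N : ℕ) : Bool :=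
  allTrue (rounds A 0 0 (A 0) N) && allTrue (rounds A 1 1 (A 1) N) &&
    allTrue (rounds A 0 1 (A 0) N)

/-- The running time, in terms of the length of the input, the length of a matrix on a stack, and
the value of the counter. -/
def runtime (W L N : ℕ) : ℕ :=
  7 * W + 3 * (8 * L + 5 + N * (4 * (10 * L ^ 2 + 16 * L + 6) + 2)) + 8 * L + 2 * N + 11

theorem exec_program {n N : ℕ} {A : Fin 2 → List (List Bool)} (hA : ∀ i, IsSquare n (A i))
    (v : List Letter)
    (hv : v.foldl readLetter (readReg 0 true, readMem (fun _ => []) 0) =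
      (readReg 1 true, readMem ![(rowsCode (A 0)).reverse, (rowsCode (A 1)).reverse] N)) :
    Exec program (reg true false, Function.update (fun _ => []) .input v)
      (reg true false, Function.update (fun _ => []) .output [answer A N])
      (runtime v.length (n * (n + 1)) N) := by
  have e0 : (reg true false, Function.update (β := fun k => List (Alphabet k)) (fun _ => [])
      Stack.input v) =
      cfg v (readReg 0 true) (readMem (fun _ => []) 0) := by
    refine congrArg (Prod.mk _) (funext fun k => ?_)
    rcases k with _ | _ | w
    · exact Function.update_self _ _ _
    · exact Function.update_of_ne (by simp) _ _
    · refine (Function.update_of_ne (by simp) _ _).trans ?_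
      rcases w with i | i | i | _ | _ | _ | _ | _ <;> try rfl
      fin_cases i <;> rfl
  have h1 := exec_parse v (readReg 0 true, readMem (fun _ => []) 0)
  rw [hv] at h1
  have h2 : Exec (load fun _ => reg true false)
      (cfg [] (readReg 1 true)
        (readMem ![(rowsCode (A 0)).reverse, (rowsCode (A 1)).reverse] N))
      (cfg [] (reg true false)
        (readMem ![(rowsCode (A 0)).reverse, (rowsCode (A 1)).reverse] N)) 1 := Exec.load _ _ _
  have h3 := (exec_move (w := .rev 0) (w' := .mat 0) (by simp) [] (reg true false)
    (readMem ![(rowsCode (A 0)).reverse, (rowsCode (A 1)).reverse] N)).congr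
    (c₃ := cfg [] (reg true false) ⟨![rowsCode (A 0), []], ![[], (rowsCode (A 1)).reverse],
      fun i => List.replicate (![N, 0] i) none, [], [], [], [], []⟩)
    (t' := 2 * (n * (n + 1)) + 2) (by
      refine congrArg (cfg [] (reg true false)) (Mem.ext ?_ ?_ ?_ rfl rfl rfl rfl rfl)
      all_goals
        funext i
        fin_cases i <;> simp [readMem, Mem.get, Mem.set])
    (by simp [readMem, Mem.get, (hA 0).length_rowsCode])
  have h4 := (exec_move (w := .rev 1) (w' := .mat 1) (by simp) [] (reg true false)
    ⟨![rowsCode (A 0), []], ![[], (rowsCode (A 1)).reverse],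
      fun i => List.replicate (![N, 0] i) none, [], [], [], [], []⟩).congr
    (c₃ := cfg [] (reg true false) (mem A [] ![N, 0]))
    (t' := 2 * (n * (n + 1)) + 2) (by
      refine congrArg (cfg [] (reg true false)) (Mem.ext ?_ ?_ ?_ rfl rfl rfl rfl rfl)
      all_goals
        funext i
        fin_cases i <;> simp [mem, Mem.get, Mem.set])
    (by simp [Mem.get, (hA 1).length_rowsCode])
  have c1 : Function.update (Function.update ![N, 0] 0 0) 1 N = ![0, N] := by
    funext i
    fin_cases i <;> simp
  have c2 : Function.update (Function.update ![0, N] 1 0) 0 N = ![N, 0] := by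
    funext i
    fin_cases i <;> simp
  have h5 := exec_test 0 0 0 1 (by decide) true hA ![N, 0] (N := N) rfl rfl
  rw [c1, Bool.true_and] at h5
  have h6 := exec_test 1 1 1 0 (by decide) (allTrue (rounds A 0 0 (A 0) N)) hA ![0, N] (N := N)
    rfl rfl
  rw [c2] at h6
  have h7 := exec_test 0 1 0 1 (by decide)
    (allTrue (rounds A 0 0 (A 0) N) && allTrue (rounds A 1 1 (A 1) N)) hA ![N, 0] (N := N) rfl rfl
  rw [c1] at h7
  change Exec _ _ (cfg [] (reg (answer A N) false) _) _ at h7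
  have h8 := exec_clear (.mat 0) [] (reg (answer A N) false) (mem A [] ![0, N])
  have h9 := exec_clear (.mat 1) [] (reg (answer A N) false) ((mem A [] ![0, N]).set (.mat 0) [])
  have h10 := exec_clear (.cnt 1) [] (reg (answer A N) false)
    (((mem A [] ![0, N]).set (.mat 0) []).set (.mat 1) [])
  set μ := (((mem A [] ![0, N]).set (.mat 0) []).set (.mat 1) []).set (.cnt 1) [] with hμ
  have h11 := Exec.push (Γ := Alphabet) .output Reg.ok (reg (answer A N) false) (allStacks [] [] μ)
  rw [update_allStacks_output] at h11
  rw [e0]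
  refine (h1.seq (h2.seq (h3.seq (h4.seq (h5.seq (h6.seq (h7.seq (h8.seq (h9.seq (h10.seq
    (h11.seq (Exec.load _ _ _)))))))))))).congr ?_ ?_
  · refine congrArg (Prod.mk _) (funext fun k => ?_)
    rcases k with _ | _ | w
    · exact (Function.update_of_ne (by simp) _ _).symm
    · exact (Function.update_self (β := fun k => List (Alphabet k)) _ _ _).symm
    · refine Eq.trans ?_ (Function.update_of_ne (β := fun k => List (Alphabet k))
        (show Stack.work w ≠ .output by simp) _ _).symm
      rcases w with i | i | i | _ | _ | _ | _ | _ <;> try rfl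
      all_goals fin_cases i <;> simp [allStacks, hμ, mem, Mem.get, Mem.set]
  · have l0 : ((mem A [] ![0, N]).get (.mat 0)).length = n * (n + 1) := (hA 0).length_rowsCode
    have l1 : (((mem A [] ![0, N]).set (.mat 0) []).get (.mat 1)).length = n * (n + 1) := by
      simp [mem, Mem.get, Mem.set, (hA 1).length_rowsCode]
    have l2 : ((((mem A [] ![0, N]).set (.mat 0) []).set (.mat 1) []).get (.cnt 1)).length = N := by
      simp [mem, Mem.get, Mem.set]
    rw [l0, l1, l2, runtime]
    omega

end Prog

/-! ### The Boolean computation and the paths -/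

section Relations

open scoped Classical in
/-- The rows of the Boolean matrix of a relation. -/
noncomputable def relRows {n : ℕ} (P : Fin n → Fin n → Prop) : List (List Bool) :=
  List.ofFn fun i => List.ofFn fun j => decide (P i j)

theorem isSquare_relRows {n : ℕ} (P : Fin n → Fin n → Prop) : IsSquare n (relRows P) := by
  refine ⟨List.length_ofFn, fun r hr => ?_⟩
  obtain ⟨i, rfl⟩ := List.mem_ofFn.1 hr
  exact List.length_ofFn

theorem boolDot_ofFn {n : ℕ} (f g : Fin n → Bool) :
    boolDot (List.ofFn f) (List.ofFn g) = true ↔ ∃ k, f k = true ∧ g k = true := by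
  induction n with
  | zero => simp [boolDot]
  | succ n ih =>
    rw [List.ofFn_succ, List.ofFn_succ, boolDot, Bool.or_eq_true, Bool.and_eq_true, ih,
      Fin.exists_fin_succ]

theorem mulTranspose_relRows {n : ℕ} (P Q : Fin n → Fin n → Prop) :
    mulTranspose (relRows P) (relRows Q) = relRows fun i j => ∃ k, P i k ∧ Q j k := by
  simp only [mulTranspose, relRows, List.map_ofFn]
  congr 1
  funext i
  rw [Function.comp_apply]
  congr 1
  funext j
  rw [Function.comp_apply, Bool.eq_iff_iff, boolDot_ofFn]
  simp

theorem allTrue_relRows {n : ℕ} (P : Fin n → Fin n → Prop) :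
    Prog.allTrue (relRows P) = true ↔ ∀ i j, P i j := by
  simp [Prog.allTrue, relRows, List.mem_ofFn]

variable {n : ℕ} {R : Fin 2 → Fin n → Fin n → Prop}

/-- The words `u` and `v` label paths from `i` and from `j`, respectively, to a common end point. -/
def Meet (R : Fin 2 → Fin n → Fin n → Prop) (u v : List (Fin 2)) (i j : Fin n) : Prop :=
  ∃ l, Reach R u i l ∧ Reach R v j l

/-- A multiplication puts a letter in front of one of the two words and exchanges them. -/
theorem mulTranspose_meet (k : Fin 2) (u v : List (Fin 2)) :
    mulTranspose (relRows (R k)) (relRows (Meet R u v)) = relRows (Meet R (k :: v) u) := by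
  rw [mulTranspose_relRows]
  congr 1
  funext i j
  refine propext ⟨?_, ?_⟩
  · rintro ⟨m, h, l, h1, h2⟩
    exact ⟨l, ⟨m, h, h2⟩, h1⟩
  · rintro ⟨l, ⟨m, h, h2⟩, h1⟩
    exact ⟨m, h, l, h1, h2⟩

/-- Each round puts `b a` in front of the word `w`. -/
theorem rounds_meet (a b : Fin 2) (w : List (Fin 2)) (N : ℕ) :
    Prog.rounds (fun k => relRows (R k)) a b (relRows (Meet R (a :: w) w)) N =
      relRows (Meet R (a :: (alternating b a N ++ w)) (alternating b a N ++ w)) := by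
  induction N generalizing w with
  | zero => rfl
  | succ N ih =>
    rw [Prog.rounds, mulTranspose_meet, mulTranspose_meet, mulTranspose_meet, mulTranspose_meet, ih,
      alternating_add, List.append_assoc]
    rfl

theorem rounds_relRows (a b : Fin 2) (N : ℕ) :
    Prog.rounds (fun k => relRows (R k)) a b (relRows (R a)) N =
      relRows (Meet R (a :: alternating b a N) (alternating b a N)) := by
  have h := rounds_meet (R := R) a b [] N
  have e : Meet R [a] [] = R a := by
    funext i j
    simp [Meet, Reach]
  rwa [e, List.append_nil] at h

theorem answer_relRows (N : ℕ) :
    Prog.answer (fun k => relRows (R k)) N = true ↔ ∀ a b, a ≤ b → ∀ i j, ∃ l,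
      Reach R (a :: alternating b a N) i l ∧ Reach R (alternating b a N) j l := by
  simp only [Prog.answer, rounds_relRows, Bool.and_eq_true, allTrue_relRows]
  constructor
  · rintro ⟨⟨h00, h11⟩, h01⟩ a b hab
    fin_cases a <;> fin_cases b
    · exact h00
    · exact h01
    · exact absurd hab (by decide)
    · exact h11
  · intro h
    exact ⟨⟨h 0 0 le_rfl, h 1 1 le_rfl⟩, h 0 1 (by decide)⟩

end Relations

/-! ### The decision procedure -/

theorem length_encodeBlocks {α : Type*} (s : Letter) (f : α → List Letter) {c : ℕ} {l : List α}
    (h : ∀ x ∈ l, c ≤ (f x).length) : l.length * (c + 1) ≤ (encodeBlocks s f l).length := by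
  induction l with
  | nil => simp
  | cons x l ih =>
    rw [List.forall_mem_cons] at h
    have e : encodeBlocks s f (x :: l) = f x ++ s :: encodeBlocks s f l := by
      simp [encodeBlocks]
    rw [e, List.length_append, List.length_cons, List.length_cons, add_mul]
    have := ih h.2
    omega

theorem length_encodeProblem (P : Problem) : 2 * (P.n * (P.n + 1) + 1) ≤
    (encodeProblem P).length := by
  refine length_encodeBlocks (l := [matrixRows (P.mat 0), matrixRows (P.mat 1)]) _ _ fun M hM => ?_
  obtain ⟨k, rfl⟩ : ∃ k, M = matrixRows (P.mat k) := by
    simp only [List.mem_cons, List.not_mem_nil, or_false] at hM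
    rcases hM with rfl | rfl
    exacts [⟨0, rfl⟩, ⟨1, rfl⟩]
  have h := length_encodeBlocks .endRow encodeRow (c := P.n) (l := matrixRows (P.mat k))
    fun r hr => by
      obtain ⟨i, rfl⟩ := List.mem_ofFn.1 hr
      have h := length_encodeBlocks .endEntry encodeRat (c := 0)
        (l := List.ofFn fun j => P.mat k i j) fun _ _ => Nat.zero_le _
      simpa [encodeRow] using h
  simpa [encodeMatrix, matrixRows] using h

/-- The graphs of the matrices of an instance. -/
def Problem.edge (P : Problem) (k : Fin 2) (i j : Fin P.n) : Prop :=
  0 < P.mat k i j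

theorem positivity_matrixRows (P : Problem) (k : Fin 2) :
    Prog.positivity (matrixRows (P.mat k)) = relRows (P.edge k) := by
  simp only [Prog.positivity, matrixRows, relRows, List.map_ofFn]
  congr 1
  funext i
  simp only [Function.comp_apply, List.map_ofFn]
  congr 1
  funext j
  rw [Function.comp_apply, decide_eq_decide]
  rfl

/-- The counter has the value `2 n²` after the input was read, which is at least `n²`, as the criterion
requires, and at most the length of the input. -/
theorem foldl_readLetter_encodeProblem (P : Problem) :
    (encodeProblem P).foldl Prog.readLetter (Prog.readReg 0 true, Prog.readMem (fun _ => []) 0) =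
      (Prog.readReg 1 true, Prog.readMem ![(rowsCode (relRows (P.edge 0))).reverse,
        (rowsCode (relRows (P.edge 1))).reverse] (P.n * P.n + P.n * P.n)) := by
  have nonneg : ∀ k, ∀ r ∈ matrixRows (P.mat k), ∀ q ∈ r, 0 ≤ q := by
    intro k r hr q hq
    obtain ⟨i, rfl⟩ := List.mem_ofFn.1 hr
    obtain ⟨j, rfl⟩ := List.mem_ofFn.1 hq
    exact Matrix.nonneg_of_mem_rowStochastic (P.stochastic k)
  have len : ∀ k, ∀ r ∈ matrixRows (P.mat k), r.length = P.n := by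
    intro k r hr
    obtain ⟨i, rfl⟩ := List.mem_ofFn.1 hr
    exact List.length_ofFn
  have h := Prog.foldl_readLetter_matrices _ _ (nonneg 0) (nonneg 1) (len 0) (len 1)
  rw [positivity_matrixRows, positivity_matrixRows] at h
  have e : ∀ k, (matrixRows (P.mat k)).length = P.n := fun _ => List.length_ofFn
  rwa [e, e] at h

theorem answer_eq_true_iff (P : Problem) :
    Prog.answer (fun k => relRows (P.edge k)) (P.n * P.n + P.n * P.n) = true ↔ P.Stable := by
  set A : Fin 2 → Matrix (Fin P.n) (Fin P.n) ℝ := fun k => (P.mat k).map ((↑) : ℚ → ℝ) with hA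
  have edge : Edge A = P.edge := by
    funext k i j
    simp [Edge, Problem.edge, hA]
  have stoch : ∀ k, A k ∈ Matrix.rowStochastic ℝ (Fin P.n) := by
    intro k
    have h := Matrix.mem_rowStochastic_iff_sum.1 (P.stochastic k)
    rw [Matrix.mem_rowStochastic_iff_sum]
    refine ⟨fun i j => ?_, fun i => ?_⟩
    · simpa [hA] using h.1 i j
    · simpa [hA] using congrArg ((↑) : ℚ → ℝ) (h.2 i)
  rw [answer_relRows, Problem.Stable, ← edge]
  refine (asymptoticallyStable_iff stoch (fun k i j h => ?_) (Nat.le_add_left _ _)).symm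
  rw [edge] at h ⊢
  exact (P.undirected k i j).1 h

theorem runtime_mono {W L L' N N' : ℕ} (hL : L ≤ L') (hN : N ≤ N') :
    Prog.runtime W L N ≤ Prog.runtime W L' N' := by
  unfold Prog.runtime
  gcongr

open Polynomial in
/-- The polynomial that bounds the running time. -/
noncomputable def timeBound : Polynomial ℕ :=
  7 * X + 3 * (8 * X + 5 + X * (4 * (10 * X ^ 2 + 16 * X + 6) + 2)) + 8 * X + 2 * X + 12

theorem runtime_succ (W : ℕ) : Prog.runtime W W W + 1 = timeBound.eval W := by
  simp [timeBound, Prog.runtime]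

theorem outputs_answer (P : Problem) : Nonempty (Turing.TM2OutputsInTime
    (Prog.program.machine .input .output (Prog.reg true false)) (encodeProblem P)
    (some [Prog.answer (fun k => relRows (P.edge k)) (P.n * P.n + P.n * P.n)])
    (timeBound.eval (encodeProblem P).length)) := by
  have hlen := length_encodeProblem P
  have h := Prog.exec_program (fun k => isSquare_relRows (P.edge k)) (encodeProblem P)
    (foldl_readLetter_encodeProblem P)
  rw [← runtime_succ]
  exact (h.mono (runtime_mono (by nlinarith) (by nlinarith))).outputs

end Consensus

theorem mainTheorem5 :
    Consensus.PolyTimeDecidable Consensus.encodeProblem Consensus.Problem.Stable := by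
  refine ⟨_, Consensus.answer_eq_true_iff, ⟨{
    tm := Consensus.Prog.program.machine .input .output (Consensus.Prog.reg true false)
    inputAlphabet := Equiv.refl _
    outputAlphabet := Equiv.refl _
    time := Consensus.timeBound
    outputsFun := fun P => ?_ }⟩⟩
  -- the alphabets of input and output are those of the statement, so the maps are the identity
  exact cast (congrArg (fun l : List Consensus.Letter => Turing.TM2OutputsInTime
    (Consensus.Prog.program.machine .input .output (Consensus.Prog.reg true false)) l _ _)
    (List.map_id _).symm) (Consensus.outputs_answer P).some
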